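/- Let $d\in\mathbb{Z}_+$ and let $f$ be a nonnegative-definite tempered Borel measure on $\mathbb{R}^d$, that is, a (nonnegative) Borel measure with $\int(1+\|x\|)^{-n}f(\mathrm{d}x)<\infty$ for some $n$ and $\int(\varphi*\varphi^*)\,\mathrm{d}f\ge 0$ for every complex Schwartz function $\varphi$, where $\varphi^*(x)=\overline{\varphi(-x)}$. Let $\hat f$ denote its spectral measure, i.e. the tempered Borel measure that is the Fourier transform of $f$: $\int\varphi\,\mathrm{d}\hat f=\int\hat\varphi\,\mathrm{d}f$ for every Schwartz function $\varphi$, with $\hat\varphi(x)=\int_{\mathbb{R}^d}e^{ix\cdot z}\varphi(z)\,\mathrm{d}z$. On a probability space $(\Omega,P)$ let $\eta$ be the Gaussian noise on $\mathbb{R}_+\times\mathbb{R}^d$ which is white in time and has spatial covariance $f$; that is, the Wiener integrals $W_t(\phi)=\int_{(0,t)\times\mathbb{R}^d}\phi(x)\,\eta(\mathrm{d}r\,\mathrm{d}x)$, for $t\ge0$ and real Schwartz functions $\phi$, form a centered Gaussian family with $$\mathrm{Cov}[W_s(\phi_1),W_t(\phi_2)]=(s\wedge t)\,\langle\phi_1,\phi_2*f\rangle_{L^2(\mathbb{R}^d)}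 .$$ For $x\in\mathbb{R}^d$ let $\eta_x$ be the shifted noise, whose Wiener integrals are $W_t(\phi_x)$, where $\phi_x(y)=\phi(y-x)$. Let $L^2(\Omega)$ be the space of square-integrable random variables $G=G(\eta)$ that are measurable functionals of the noise, and associate to each such $G$ the random field $G(x):=G\circ\theta_x:=G(\eta_x)$, $x\in\mathbb{R}^d$. Then $\{G(x)\}_{x\in\mathbb{R}^d}$ is stationary for every $G\in L^2(\Omega)$. Moreover, the following are equivalent: 1. $\{G(x)\}_{x\in\mathbb{R}^d}$ is ergodic for every $G\in L^2(\Omega)$ such that $x\mapsto G(x)$ is continuous in probability; 2. $\hat f\{0\}=0$. Here a stationary field is ergodic if every measurable set $A\subset\mathbb{R}^{\mathbb{R}^d}$ that is invariant, up to null sets of the law of the field, under each spatial shift has probability $0$ or $1$ under that law. -/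

import Mathlib

open MeasureTheory ProbabilityTheory Filter Topology
open scoped SchwartzMap NNReal ENNReal ComplexOrder

noncomputable section

namespace NoiseErgodicity

/-- Euclidean space `ℝ^d`. -/
abbrev E (d : ℕ) : Type := EuclideanSpace ℝ (Fin d)

/-- A Borel measure `f` on `ℝ^d` is nonnegative definite: `∫ (φ * φ^*) df ≥ 0` for every complex
Schwartz function `φ`, where `φ^*(x) = conj (φ (-x))`, so that
`(φ * φ^*)(z) = ∫ φ(x) conj (φ(x - z)) dx`. The inequality is that of `ℂ`:
the integral is real and nonnegative. -/
def IsNonnegDefinite {d : ℕ} (f : Measure (E d)) : Prop :=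
  ∀ φ : 𝓢(E d, ℂ), 0 ≤ ∫ z, (∫ x, φ x * (starRingEnd ℂ) (φ (x - z)) ∂volume) ∂f

/-- The Fourier transform `∫ e^{i x·z} φ(z) dz` of a Schwartz function. -/
def fourierInt {d : ℕ} (φ : 𝓢(E d, ℂ)) (x : E d) : ℂ :=
  ∫ z, Complex.exp (Complex.I * ((inner ℝ x z : ℝ) : ℂ)) * φ z

/-- The measure `ν` is the Fourier transform, in the sense of tempered distributions, of the
measure `f`. -/
def IsFourierTransform {d : ℕ} (f ν : Measure (E d)) : Prop :=
  ∀ φ : 𝓢(E d, ℂ), ∫ z, φ z ∂ν = ∫ x, fourierInt φ x ∂f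

open Classical in
/-- The spectral measure of `f`: the tempered measure that is the Fourier transform of `f`.
It is unique when it exists, and it exists when `f` is tempered and nonnegative definite;
the value `0` is used for all other measures. -/
def spectralMeasure {d : ℕ} (f : Measure (E d)) : Measure (E d) :=
  if h : ∃ ν : Measure (E d), ν.HasTemperateGrowth ∧ IsFourierTransform f ν then h.choose else 0

/-- The index set of the noise: pairs `(t, φ)`, which stand for the space-time function
`1_{(0,t)} ⊗ φ`. -/
abbrev Idx (d : ℕ) : Type := ℝ≥0 × 𝓢(E d, ℝ)

/-- `W` is the Gaussian noise, white in time and with spatial covariance `f`, given through its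
Wiener integrals `W (t, φ) = ∫_{(0,t) × ℝ^d} φ(x) η(dr dx)`: a centered Gaussian family with
`Cov (W (s, φ), W (t, ψ)) = (s ∧ t) ⟨φ, ψ * f⟩_{L²(ℝ^d)}`. -/
structure IsNoise {d : ℕ} {Ω : Type*} [MeasurableSpace Ω] (f : Measure (E d))
    (W : Idx d → Ω → ℝ) (P : Measure Ω) : Prop where
  measurable : ∀ i, Measurable (W i)
  gaussian : IsGaussianProcess W P
  centered : ∀ i, ∫ ω, W i ω ∂P = 0
  covariance_eq : ∀ (s t : ℝ≥0) (φ ψ : 𝓢(E d, ℝ)),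
    cov[W (s, φ), W (t, ψ); P] = ((min s t : ℝ≥0) : ℝ) * ∫ x, φ x * (∫ y, ψ (x - y) ∂f) ∂volume

/-- The shift `η ↦ η_y` of a noise configuration: `η_y(t, φ) = η(t, φ_y)`, with
`φ_y(x) = φ(x - y)`. -/
def shiftNoise {d : ℕ} (y : E d) (η : Idx d → ℝ) : Idx d → ℝ :=
  fun i => η (i.1, SchwartzMap.compSubConstCLM ℝ y i.2)

/-- The random field `x ↦ G ∘ θ_x` attached to the functional `G` of the noise `W`:
`(G ∘ θ_x)(η) = G(η_x)`. -/
def shiftField {d : ℕ} {Ω : Type*} (W : Idx d → Ω → ℝ) (G : (Idx d → ℝ) → ℝ) :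
    E d → Ω → ℝ :=
  fun x ω => G (shiftNoise x (fun i => W i ω))

/-- `G` represents an element of `L²(Ω)`, where `Ω` carries the σ-algebra of the noise: a
measurable functional `G(η)` of the noise which is square integrable. -/
def IsL2Functional {d : ℕ} {Ω : Type*} [MeasurableSpace Ω] (W : Idx d → Ω → ℝ) (P : Measure Ω)
    (G : (Idx d → ℝ) → ℝ) : Prop :=
  Measurable G ∧ MemLp (fun ω => G (fun i => W i ω)) 2 P

/-- Stationarity: all spatial translates of the random field have the same law on `ℝ^(ℝ^d)`
(equivalently, the same finite-dimensional distributions). -/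
def IsStationaryField {d : ℕ} {Ω : Type*} [MeasurableSpace Ω] (P : Measure Ω)
    (X : E d → Ω → ℝ) : Prop :=
  ∀ y : E d, IdentDistrib (fun ω x => X (x + y) ω) (fun ω x => X x ω) P P

/-- Continuity in probability of a random field. -/
def IsContinuousInProbability {d : ℕ} {Ω : Type*} [MeasurableSpace Ω] (P : Measure Ω)
    (X : E d → Ω → ℝ) : Prop :=
  ∀ x : E d, TendstoInMeasure P X (𝓝 x) (X x)

/-- Ergodicity of a random field: under its law on `ℝ^(ℝ^d)`, every measurable set of functions
which is invariant, up to null sets, under each spatial shift has probability `0` or `1`.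
(Invariance up to null sets is essential: a set of the product σ-algebra depends on
countably many coordinates only, so that hardly any set is invariant pointwise.) -/
def IsErgodicField {d : ℕ} {Ω : Type*} [MeasurableSpace Ω] (P : Measure Ω)
    (X : E d → Ω → ℝ) : Prop :=
  ∀ A : Set (E d → ℝ), MeasurableSet A →
    (∀ y : E d, (fun (u : E d → ℝ) (x : E d) => u (x + y)) ⁻¹' A
      =ᵐ[P.map (fun ω x => X x ω)] A) →
    P.map (fun ω x => X x ω) A = 0 ∨ P.map (fun ω x => X x ω) A = 1

end NoiseErgodicity

end

/-!
The spectral measure is the limit, as `ε → 0`, of the measures whose densities are the Fourier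
transforms of `exp (-ε ‖x‖²) f(dx)`, nonnegative because `f` is nonnegative definite.

As the Fourier transform of a Gaussian is Gaussian, the averages of the translates of `f` against
wider and wider Gaussians are bounded, uniformly in the translate, by quantities which tend to a
multiple of `f̂{0}`. If `f̂{0} = 0`, the covariances of Wiener integrals with translates of other
ones therefore tend to `0` in mean, hence along a filter of translations of asymptotic density one.
For a Gaussian family this makes `exp (i X)`, with `X` a linear combination of Wiener integrals,
asymptotically uncorrelated with its translates, which thus converge weakly in `L²` to its mean.
Their integrals over an invariant event do not depend on the translation, so such an event is
independent of the noise, and hence of itself. If `f̂{0} ≠ 0`, the Wiener integrals of wider and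
wider Gaussian densities converge in `L²` to a shift-invariant variable of positive variance, whose
field is constant in `x` but not deterministic.
-/

namespace NoiseErgodicity

open Complex (I)

variable {d : ℕ}

section Gaussian

variable {V : Type*} [NormedAddCommGroup V] [InnerProductSpace ℝ V]

lemma one_add_pow_mul_exp_neg_mul_sq_le {b : ℝ} (hb : 0 < b) (m : ℕ) {r : ℝ} (hr : 0 ≤ r) :
    (1 + r) ^ m * Real.exp (-b * r ^ 2) ≤ m.factorial * (2 / b) ^ m * Real.exp b := by
  have hpow : (1 + r) ^ m ≤ m.factorial * (2 / b) ^ m * Real.exp (b / 2 * (1 + r) ^ 2) := by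
    have h := Real.pow_div_factorial_le_exp (x := b / 2 * (1 + r) ^ 2) (by positivity) m
    rw [div_le_iff₀ (by positivity), mul_pow] at h
    calc (1 + r) ^ m ≤ ((1 + r) ^ 2) ^ m := by gcongr; nlinarith
      _ = (2 / b) ^ m * ((b / 2) ^ m * ((1 + r) ^ 2) ^ m) := by
        rw [← mul_assoc, ← mul_pow]
        field_simp
        simp
      _ ≤ (2 / b) ^ m * (Real.exp (b / 2 * (1 + r) ^ 2) * m.factorial) := by gcongr
      _ = _ := by ring
  calc (1 + r) ^ m * Real.exp (-b * r ^ 2)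
      ≤ m.factorial * (2 / b) ^ m * Real.exp (b / 2 * (1 + r) ^ 2) * Real.exp (-b * r ^ 2) := by
        gcongr
    _ = m.factorial * (2 / b) ^ m * Real.exp (b / 2 * (1 + r) ^ 2 + -b * r ^ 2) := by
        rw [mul_assoc, ← Real.exp_add]
    _ ≤ _ := by
        gcongr
        nlinarith [mul_nonneg hb.le (sq_nonneg (r - 1))]

lemma exists_norm_iteratedFDeriv_exp_neg_mul_sq_norm_le (b : ℝ) (n : ℕ) :
    ∃ l : ℕ, ∃ C : ℝ, 0 ≤ C ∧ ∀ x : V,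
      ‖iteratedFDeriv ℝ n (fun y : V => Real.exp (-b * ‖y‖ ^ 2)) x‖ ≤
        C * (1 + ‖x‖) ^ l * Real.exp (-b * ‖x‖ ^ 2) := by
  have hq : (fun x : V => -b * ‖x‖ ^ 2).HasTemperateGrowth := by fun_prop
  obtain ⟨l, C, hC, hgrowth⟩ := hq.norm_iteratedFDeriv_le_uniform n
  refine ⟨l * n, n.factorial * (C + 1) ^ n, by positivity, fun x => ?_⟩
  have hgrowth' (N : ℕ) (hN₁ : 1 ≤ N) (hN₂ : N ≤ n) :
      ‖iteratedFDeriv ℝ N (fun y : V => -b * ‖y‖ ^ 2) x‖ ≤ ((C + 1) * (1 + ‖x‖) ^ l) ^ N :=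
    calc _ ≤ C * (1 + ‖x‖) ^ l := hgrowth N hN₂ x
      _ ≤ (C + 1) * (1 + ‖x‖) ^ l := by gcongr; linarith
      _ ≤ _ := le_self_pow₀ (one_le_mul_of_one_le_of_one_le (by linarith)
          (one_le_pow₀ (by linarith [norm_nonneg x]))) (by omega)
  have hexp (i : ℕ) : ‖iteratedFDeriv ℝ i Real.exp (-b * ‖x‖ ^ 2)‖ ≤ Real.exp (-b * ‖x‖ ^ 2) := by
    rw [norm_iteratedFDeriv_eq_norm_iteratedDeriv, iteratedDeriv_eq_iterate,
      Real.iter_deriv_exp, Real.norm_eq_abs, Real.abs_exp]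
  calc _ ≤ n.factorial * Real.exp (-b * ‖x‖ ^ 2) * ((C + 1) * (1 + ‖x‖) ^ l) ^ n :=
        norm_iteratedFDeriv_comp_le (N := ((⊤ : ℕ∞) : WithTop ℕ∞)) Real.contDiff_exp hq.1
          (mod_cast le_top) x (fun i _ => hexp i) hgrowth'
    _ = _ := by
        rw [mul_pow, ← pow_mul]
        ring

/-- The Gaussian `x ↦ exp (-b ‖x‖²)` as a real Schwartz function. -/
noncomputable def gaussianSchwartz (b : ℝ) (hb : 0 < b) : 𝓢(V, ℝ) where
  toFun x := Real.exp (-b * ‖x‖ ^ 2)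
  smooth' := Real.contDiff_exp.comp (contDiff_const.mul (contDiff_norm_sq ℝ))
  decay' k n := by
    obtain ⟨l, C, hC, hle⟩ := exists_norm_iteratedFDeriv_exp_neg_mul_sq_norm_le (V := V) b n
    refine ⟨C * ((k + l).factorial * (2 / b) ^ (k + l) * Real.exp b), fun x => ?_⟩
    calc _ ≤ (1 + ‖x‖) ^ k * (C * (1 + ‖x‖) ^ l * Real.exp (-b * ‖x‖ ^ 2)) := by
          gcongr
          · simp
          · exact hle x
      _ = C * ((1 + ‖x‖) ^ (k + l) * Real.exp (-b * ‖x‖ ^ 2)) := by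
          rw [pow_add]
          ring
      _ ≤ _ := mul_le_mul_of_nonneg_left
          (one_add_pow_mul_exp_neg_mul_sq_le hb _ (norm_nonneg x)) hC

@[simp] lemma gaussianSchwartz_apply (b : ℝ) (hb : 0 < b) (x : V) :
    gaussianSchwartz b hb x = Real.exp (-b * ‖x‖ ^ 2) := rfl

lemma iteratedDeriv_cexp_ofReal_mul_I (n : ℕ) :
    iteratedDeriv n (fun t : ℝ => Complex.exp (t * I)) =
      fun t : ℝ => I ^ n * Complex.exp (t * I) := by
  induction n with
  | zero => simp
  | succ n ih =>
    rw [iteratedDeriv_succ, ih]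
    funext t
    have h : HasDerivAt (fun t : ℝ => (t : ℂ) * I) I t := by
      simpa using (Complex.ofRealCLM.hasDerivAt (x := t)).mul_const I
    rw [(h.cexp.const_mul (I ^ n)).deriv]
    ring

lemma hasTemperateGrowth_cexp_inner_mul_I (u : V) :
    (fun x : V => Complex.exp ((inner ℝ u x : ℝ) * I)).HasTemperateGrowth := by
  have h : (fun t : ℝ => Complex.exp (t * I)).HasTemperateGrowth := by
    refine ⟨(Complex.ofRealCLM.contDiff.mul contDiff_const).cexp, fun n => ⟨0, 1, fun t => ?_⟩⟩
    rw [norm_iteratedFDeriv_eq_norm_iteratedDeriv, iteratedDeriv_cexp_ofReal_mul_I]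
    simp [Complex.norm_exp_ofReal_mul_I]
  exact h.comp (Function.hasTemperateGrowth_inner_right u)

/-- The modulated Gaussian `x ↦ exp (-b ‖x‖² + i ⟨u, x⟩)` as a complex Schwartz function. -/
noncomputable def modulatedGaussian (b : ℝ) (hb : 0 < b) (u : V) : 𝓢(V, ℂ) :=
  SchwartzMap.smulLeftCLM ℂ (fun x : V => Complex.exp ((inner ℝ u x : ℝ) * I))
    ((gaussianSchwartz b hb).postcompCLM Complex.ofRealCLM)

lemma modulatedGaussian_apply (b : ℝ) (hb : 0 < b) (u x : V) :
    modulatedGaussian b hb u x = Complex.exp (-b * ‖x‖ ^ 2 + I * (inner ℝ u x : ℝ)) := by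
  rw [modulatedGaussian,
    SchwartzMap.smulLeftCLM_apply_apply (hasTemperateGrowth_cexp_inner_mul_I u)]
  simp only [SchwartzMap.postcompCLM_apply, gaussianSchwartz_apply, Complex.ofRealCLM_apply,
    smul_eq_mul, Complex.ofReal_exp, ← Complex.exp_add]
  congr 1
  push_cast
  ring

lemma norm_cexp_neg_mul_sq_norm_add_I_mul (b : ℝ) (u x : V) :
    ‖Complex.exp (-b * ‖x‖ ^ 2 + I * (inner ℝ u x : ℝ))‖ = Real.exp (-b * ‖x‖ ^ 2) := by
  rw [Complex.norm_exp]
  simp [← Complex.ofReal_pow]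

variable (V) in
/-- The total mass `(π / b) ^ (dim V / 2)` of the Gaussian `exp (-b ‖x‖²)`. -/
noncomputable def gaussMass (b : ℝ) : ℝ := (Real.pi / b) ^ ((Module.finrank ℝ V : ℝ) / 2)

lemma gaussMass_pos {b : ℝ} (hb : 0 < b) : 0 < gaussMass V b := by
  unfold gaussMass
  positivity

lemma gaussMass_mul_gaussMass_inv_four_mul {b : ℝ} (hb : 0 < b) :
    gaussMass V b * gaussMass V (1 / (4 * b)) = (2 * Real.pi) ^ Module.finrank ℝ V := by
  have hsq : Real.pi / b * (Real.pi / (1 / (4 * b))) = (2 * Real.pi) ^ 2 := by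
    field_simp
    ring
  rw [gaussMass, gaussMass, ← Real.mul_rpow (by positivity) (by positivity), hsq,
    ← Real.rpow_natCast, ← Real.rpow_mul (by positivity), ← Real.rpow_natCast]
  congr 1
  push_cast
  ring

lemma gaussMass_le_of_le_one {t : ℝ} (ht : 0 < t) (ht1 : t ≤ 1) :
    gaussMass V t ≤ gaussMass V 1 * (t ^ Module.finrank ℝ V)⁻¹ := by
  unfold gaussMass
  rw [div_one, Real.div_rpow Real.pi_pos.le ht.le, div_eq_mul_inv]
  gcongr
  rw [← Real.rpow_natCast]
  exact Real.rpow_le_rpow_of_exponent_ge ht ht1 (half_le_self (Nat.cast_nonneg _))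

variable [MeasurableSpace V] [BorelSpace V]

lemma integrable_exp_neg_mul_sq_norm [SecondCountableTopology V] (f : Measure V)
    [f.HasTemperateGrowth] {b : ℝ} (hb : 0 < b) :
    Integrable (fun x => Real.exp (-b * ‖x‖ ^ 2)) f :=
  (gaussianSchwartz b hb).integrable

variable [FiniteDimensional ℝ V]

lemma integral_cexp_neg_mul_sq_norm_add {b : ℝ} (hb : 0 < b) (c : ℂ) (w : V) :
    ∫ v : V, Complex.exp (-b * ‖v‖ ^ 2 + c * (inner ℝ w v : ℝ)) =
      gaussMass V b * Complex.exp (c ^ 2 * ‖w‖ ^ 2 / (4 * b)) := by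
  rw [GaussianFourier.integral_cexp_neg_mul_sq_norm_add (b := (b : ℂ)) (by simpa) c w, gaussMass,
    Complex.ofReal_cpow (by positivity)]
  simp

lemma integral_rexp_neg_mul_sq_norm_add {b : ℝ} (hb : 0 < b) (c : ℝ) (w : V) :
    ∫ v : V, Real.exp (-b * ‖v‖ ^ 2 + c * inner ℝ w v) =
      gaussMass V b * Real.exp (c ^ 2 * ‖w‖ ^ 2 / (4 * b)) := by
  have h := integral_cexp_neg_mul_sq_norm_add hb (c : ℂ) w
  rw [← Complex.ofReal_inj, ← integral_complex_ofReal]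
  push_cast
  exact h

lemma integral_modulatedGaussian_mul_conj {ε : ℝ} (hε : 0 < ε) (z y : V) :
    ∫ x, modulatedGaussian (2 * ε) (by positivity) z x *
      (starRingEnd ℂ) (modulatedGaussian (2 * ε) (by positivity) z (x - y)) =
      gaussMass V (4 * ε) * Complex.exp (-ε * ‖y‖ ^ 2 + I * (inner ℝ z y : ℝ)) := by
  have hprod (x : V) : modulatedGaussian (2 * ε) (by positivity) z x *
      (starRingEnd ℂ) (modulatedGaussian (2 * ε) (by positivity) z (x - y)) =
      Complex.exp (-(2 * ε : ℝ) * ‖y‖ ^ 2 + I * (inner ℝ z y : ℝ)) *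
        Complex.exp (-(4 * ε : ℝ) * ‖x‖ ^ 2 + (4 * ε : ℝ) * (inner ℝ y x : ℝ)) := by
    rw [modulatedGaussian_apply, modulatedGaussian_apply, ← Complex.exp_conj, ← Complex.exp_add,
      ← Complex.exp_add]
    have hsq : ((‖x - y‖ : ℝ) : ℂ) ^ 2 = ‖x‖ ^ 2 - 2 * (inner ℝ y x : ℝ) + ‖y‖ ^ 2 := by
      have := norm_sub_sq_real x y
      rw [real_inner_comm] at this
      exact_mod_cast congrArg ((↑) : ℝ → ℂ) this
    simp only [map_add, map_mul, map_neg, map_pow, Complex.conj_ofReal, Complex.conj_I,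
      inner_sub_right]
    rw [hsq]
    push_cast
    ring_nf
  simp_rw [hprod]
  rw [integral_const_mul, integral_cexp_neg_mul_sq_norm_add (by positivity), mul_left_comm,
    ← Complex.exp_add]
  congr 2
  have : (ε : ℂ) ≠ 0 := by exact_mod_cast hε.ne'
  push_cast
  field_simp
  ring

end Gaussian

lemma fourierInt_modulatedGaussian (b : ℝ) (hb : 0 < b) (u x : E d) :
    fourierInt (modulatedGaussian b hb u) x =
      ((gaussMass (E d) b * Real.exp (-(1 / (4 * b)) * ‖x + u‖ ^ 2) : ℝ) : ℂ) := by
  have hexp (z : E d) : Complex.exp (I * (inner ℝ x z : ℝ)) * modulatedGaussian b hb u z =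
      Complex.exp (-b * ‖z‖ ^ 2 + I * (inner ℝ (x + u) z : ℝ)) := by
    rw [modulatedGaussian_apply, ← Complex.exp_add, inner_add_left]
    congr 1
    push_cast
    ring
  simp only [fourierInt, hexp]
  rw [integral_cexp_neg_mul_sq_norm_add hb]
  push_cast
  rw [Complex.I_sq]
  congr 2
  field_simp

section TemperedMeasure

variable {V : Type*} [NormedAddCommGroup V] [MeasurableSpace V]

lemma isLocallyFiniteMeasure_of_hasTemperateGrowth [OpensMeasurableSpace V] (f : Measure V)
    [hf : f.HasTemperateGrowth] : IsLocallyFiniteMeasure f := by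
  obtain ⟨n, hn⟩ := hf.exists_integrable
  refine ⟨fun x => ⟨Metric.ball x 1, Metric.ball_mem_nhds x one_pos, ?_⟩⟩
  have hx : (0 : ℝ) < (2 + ‖x‖) ^ (-(n : ℝ)) := by positivity
  refine (measure_mono fun y hy => ?_).trans_lt (hn.measure_norm_ge_lt_top hx)
  have hy' : 1 + ‖y‖ ≤ 2 + ‖x‖ := by
    have h1 := norm_le_norm_add_norm_sub' y x
    have h2 := mem_ball_iff_norm.1 hy
    linarith
  rw [Set.mem_ofPred_eq, Real.norm_of_nonneg (by positivity)]
  exact Real.rpow_le_rpow_of_nonpos (by positivity) hy' (by simp)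

lemma sigmaFinite_of_hasTemperateGrowth [OpensMeasurableSpace V] [SecondCountableTopology V]
    (f : Measure V) [f.HasTemperateGrowth] : SigmaFinite f := by
  have := isLocallyFiniteMeasure_of_hasTemperateGrowth f
  infer_instance

lemma hasTemperateGrowth_withDensity_one_add_sq_pow [BorelSpace V] [SecondCountableTopology V]
    (μ : Measure V) [IsFiniteMeasure μ] (k : ℕ) :
    (μ.withDensity fun z => ENNReal.ofReal ((1 + ‖z‖ ^ 2) ^ k)).HasTemperateGrowth := by
  refine ⟨2 * k, ?_⟩
  rw [integrable_withDensity_iff_integrable_smul₀' (by fun_prop) (by simp)]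
  refine Integrable.mono' (integrable_const (1 : ℝ)) (by fun_prop)
    (Eventually.of_forall fun z => ?_)
  rw [ENNReal.toReal_ofReal (by positivity), smul_eq_mul, Real.rpow_neg (by positivity),
    Real.rpow_natCast, Real.norm_eq_abs, abs_of_nonneg (by positivity),
    ← div_eq_mul_inv, div_le_one (by positivity), pow_mul]
  gcongr
  nlinarith [norm_nonneg z]

lemma withDensity_one_div_compl_closedBall_le [OpensMeasurableSpace V] (μ : Measure V) (n : ℕ) :
    (μ.withDensity fun z => ENNReal.ofReal (1 / (1 + ‖z‖ ^ 2))) (Metric.closedBall 0 n)ᶜ ≤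
      ENNReal.ofReal (1 / (n + 1)) * μ Set.univ := by
  rw [withDensity_apply _ measurableSet_closedBall.compl]
  calc _ ≤ ∫⁻ _ in (Metric.closedBall 0 n)ᶜ, ENNReal.ofReal (1 / (n + 1)) ∂μ := by
        refine setLIntegral_mono' measurableSet_closedBall.compl fun z hz => ?_
        have hz' : (n : ℝ) < ‖z‖ := by simpa using hz
        refine ENNReal.ofReal_le_ofReal (one_div_le_one_div_of_le (by positivity) ?_)
        have hn : (n : ℝ) ≤ n ^ 2 := by exact_mod_cast Nat.le_self_pow two_ne_zero n
        have : (n : ℝ) ^ 2 ≤ ‖z‖ ^ 2 := by gcongr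
        linarith
    _ ≤ _ := by
        rw [setLIntegral_const]
        gcongr
        exact Set.subset_univ _

lemma withDensity_one_div_univ_le (μ : Measure V) :
    (μ.withDensity fun z => ENNReal.ofReal (1 / (1 + ‖z‖ ^ 2))) Set.univ ≤ μ Set.univ := by
  rw [withDensity_apply _ MeasurableSet.univ, Measure.restrict_univ, ← lintegral_one]
  refine lintegral_mono fun z => ENNReal.ofReal_le_one.2 ?_
  rw [div_le_one (by positivity)]
  linarith [sq_nonneg ‖z‖]

lemma exists_tendsto_withDensity_one_div [ProperSpace V] [BorelSpace V]
    {ι : Type*} (l : Ultrafilter ι) {m : ι → Measure V} {μ : ι → FiniteMeasure V} {C : ℝ≥0}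
    (hm : ∀ i, m i Set.univ ≤ C)
    (hμ : ∀ i, (μ i : Measure V) =
      (m i).withDensity fun z => ENNReal.ofReal (1 / (1 + ‖z‖ ^ 2))) :
    ∃ μ' : FiniteMeasure V, Tendsto μ l (𝓝 μ') := by
  have hcompact := isCompact_setOfPred_finiteMeasure_mass_le_compl_isCompact_le (E := V)
    (u := fun n : ℕ => C * (1 / ((n : ℝ≥0) + 1))) (K := fun n : ℕ => Metric.closedBall 0 (n : ℝ)) C
    (by simpa using (tendsto_one_div_add_atTop_nhds_zero_nat (𝕜 := ℝ≥0)).const_mul C)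
    (fun n => isCompact_closedBall _ _) (Or.inl inferInstance)
  have hmem (i : ι) : μ i ∈ {μ : FiniteMeasure V | μ.mass ≤ C ∧
      ∀ n : ℕ, μ (Metric.closedBall 0 (n : ℝ))ᶜ ≤ C * (1 / ((n : ℝ≥0) + 1))} := by
    refine ⟨?_, fun n => ?_⟩
    · rw [← ENNReal.coe_le_coe, FiniteMeasure.ennreal_mass, hμ]
      exact (withDensity_one_div_univ_le _).trans (hm i)
    · rw [← ENNReal.coe_le_coe, FiniteMeasure.ennreal_coeFn_eq_coeFn_toMeasure, hμ]
      refine (withDensity_one_div_compl_closedBall_le _ n).trans ?_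
      rw [mul_comm, ENNReal.coe_mul]
      refine mul_le_mul' (hm i) (le_of_eq ?_)
      rw [ENNReal.ofReal]
      congr 1
      ext
      rw [Real.coe_toNNReal _ (by positivity)]
      simp
  obtain ⟨μ', -, hμ'⟩ := isCompact_iff_ultrafilter_le_nhds.1 hcompact (l.map μ) (by
    rw [Ultrafilter.coe_map, le_principal_iff, mem_map]
    exact Eventually.of_forall hmem)
  exact ⟨μ', hμ'⟩

end TemperedMeasure

lemma exists_schwartz_eq_fourierInt (φ : 𝓢(E d, ℂ)) :
    ∃ ψ : 𝓢(E d, ℂ), ∀ x, fourierInt φ x = ψ x := by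
  have hpi : Real.pi ≠ 0 := Real.pi_pos.ne'
  let e : E d ≃L[ℝ] E d :=
    ContinuousLinearEquiv.smulLeft (Units.mk0 (-(1 / (2 * Real.pi))) (by simp [hpi]))
  refine ⟨SchwartzMap.compCLMOfContinuousLinearEquiv ℂ e (FourierTransform.fourier φ), fun x => ?_⟩
  have he : e x = (-(1 / (2 * Real.pi))) • x := rfl
  rw [SchwartzMap.compCLMOfContinuousLinearEquiv_apply, Function.comp_apply, he,
    SchwartzMap.fourier_coe, Real.fourier_eq', fourierInt]
  refine integral_congr_ae (Eventually.of_forall fun z => ?_)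
  dsimp only
  have hphase : -2 * Real.pi * (-(1 / (2 * Real.pi)) * inner ℝ x z) = inner ℝ x z := by field_simp
  rw [smul_eq_mul, inner_smul_right, real_inner_comm x z, hphase, mul_comm I]

lemma integrable_fourierInt (f : Measure (E d)) [f.HasTemperateGrowth] (φ : 𝓢(E d, ℂ)) :
    Integrable (fourierInt φ) f := by
  obtain ⟨ψ, hψ⟩ := exists_schwartz_eq_fourierInt φ
  rw [funext hψ]
  exact ψ.integrable

/-- The real part of the Fourier transform of the finite measure `exp (-ε ‖x‖²) f(dx)`. For
nonnegative definite `f` it is the whole transform, and as `ε → 0` it is the density of an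
approximation of the spectral measure. -/
noncomputable def smoothedSpectral (f : Measure (E d)) (ε : ℝ) (z : E d) : ℝ :=
  (∫ x, Complex.exp (-ε * ‖x‖ ^ 2 + I * (inner ℝ z x : ℝ)) ∂f).re

lemma abs_smoothedSpectral_le (f : Measure (E d)) (ε : ℝ) (z : E d) :
    |smoothedSpectral f ε z| ≤ ∫ x, Real.exp (-ε * ‖x‖ ^ 2) ∂f := by
  refine (Complex.abs_re_le_norm _).trans ((norm_integral_le_integral_norm _).trans_eq ?_)
  simp_rw [norm_cexp_neg_mul_sq_norm_add_I_mul]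

lemma continuous_smoothedSpectral (f : Measure (E d)) [f.HasTemperateGrowth] {ε : ℝ}
    (hε : 0 < ε) : Continuous (smoothedSpectral f ε) := by
  refine Complex.continuous_re.comp (continuous_of_dominated
    (bound := fun x => Real.exp (-ε * ‖x‖ ^ 2)) (fun z => ?_) (fun z => ?_)
    (integrable_exp_neg_mul_sq_norm f hε) ?_)
  · exact Continuous.aestronglyMeasurable (by fun_prop)
  · exact Eventually.of_forall fun x => (norm_cexp_neg_mul_sq_norm_add_I_mul ε z x).le
  · exact Eventually.of_forall fun x => by fun_prop

namespace IsNonnegDefinite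

variable {f : Measure (E d)} {ε : ℝ}

lemma integral_cexp_nonneg (hf : IsNonnegDefinite f) (hε : 0 < ε) (z : E d) :
    0 ≤ ∫ x, Complex.exp (-ε * ‖x‖ ^ 2 + I * (inner ℝ z x : ℝ)) ∂f := by
  have h := hf (modulatedGaussian (2 * ε) (by positivity) z)
  simp_rw [integral_modulatedGaussian_mul_conj hε z] at h
  rw [integral_const_mul] at h
  have hmass : 0 < gaussMass (E d) (4 * ε) := gaussMass_pos (by positivity)
  have hmass' : (gaussMass (E d) (4 * ε) : ℂ) ≠ 0 := by exact_mod_cast hmass.ne'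
  rw [← inv_mul_cancel_left₀ hmass'
    (∫ x, Complex.exp (-ε * ‖x‖ ^ 2 + I * (inner ℝ z x : ℝ)) ∂f), ← Complex.ofReal_inv]
  exact mul_nonneg (by exact_mod_cast (inv_pos.2 hmass).le) h

lemma smoothedSpectral_nonneg (hf : IsNonnegDefinite f) (hε : 0 < ε) (z : E d) :
    0 ≤ smoothedSpectral f ε z :=
  (Complex.nonneg_iff.1 (hf.integral_cexp_nonneg hε z)).1

lemma ofReal_smoothedSpectral (hf : IsNonnegDefinite f) (hε : 0 < ε) (z : E d) :
    (smoothedSpectral f ε z : ℂ) =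
      ∫ x, Complex.exp (-ε * ‖x‖ ^ 2 + I * (inner ℝ z x : ℝ)) ∂f :=
  Complex.ext rfl (by simpa using (Complex.nonneg_iff.1 (hf.integral_cexp_nonneg hε z)).2)

variable [f.HasTemperateGrowth]

lemma integral_mul_smoothedSpectral (hf : IsNonnegDefinite f) (hε : 0 < ε) (φ : 𝓢(E d, ℂ)) :
    ∫ z, φ z * smoothedSpectral f ε z =
      ∫ x, Real.exp (-ε * ‖x‖ ^ 2) * fourierInt φ x ∂f := by
  have := sigmaFinite_of_hasTemperateGrowth f
  have h_integrable : Integrable (Function.uncurry fun z x : E d =>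
      φ z * Complex.exp (-ε * ‖x‖ ^ 2 + I * (inner ℝ z x : ℝ))) (volume.prod f) := by
    refine Integrable.mono ((φ.integrable (μ := volume)).mul_prod
      (integrable_exp_neg_mul_sq_norm f hε).ofReal) ?_ (Eventually.of_forall fun p => ?_)
    · refine Continuous.aestronglyMeasurable ?_
      simp only [Function.uncurry_def]
      fun_prop
    · simp only [Function.uncurry_def, norm_mul, norm_cexp_neg_mul_sq_norm_add_I_mul,
        Complex.coe_algebraMap, Complex.norm_real, Real.norm_eq_abs, Real.abs_exp, le_refl]
  simp_rw [hf.ofReal_smoothedSpectral hε, ← integral_const_mul]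
  rw [integral_integral_swap h_integrable]
  refine integral_congr_ae (Eventually.of_forall fun x => ?_)
  simp only [fourierInt, ← integral_const_mul]
  refine integral_congr_ae (Eventually.of_forall fun z => ?_)
  dsimp only
  rw [Complex.exp_add, real_inner_comm]
  push_cast
  ring

lemma tendsto_integral_mul_smoothedSpectral (hf : IsNonnegDefinite f) (φ : 𝓢(E d, ℂ)) :
    Tendsto (fun ε : ℝ => ∫ z, φ z * smoothedSpectral f ε z) (𝓝[>] 0)
      (𝓝 (∫ x, fourierInt φ x ∂f)) := by
  have hpos : ∀ᶠ ε : ℝ in 𝓝[>] 0, 0 < ε := self_mem_nhdsWithin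
  refine Tendsto.congr' (hpos.mono fun ε hε => (hf.integral_mul_smoothedSpectral hε φ).symm) ?_
  refine tendsto_integral_filter_of_dominated_convergence (fun x => ‖fourierInt φ x‖)
    (Eventually.of_forall fun ε => ?_) (hpos.mono fun ε hε => Eventually.of_forall fun x => ?_)
    (integrable_fourierInt f φ).norm (Eventually.of_forall fun x => ?_)
  · exact (Continuous.aestronglyMeasurable (by fun_prop)).mul
      (integrable_fourierInt f φ).aestronglyMeasurable
  · rw [norm_mul, Complex.norm_real, Real.norm_eq_abs, Real.abs_exp]
    refine mul_le_of_le_one_left (norm_nonneg _) (Real.exp_le_one_iff.2 ?_)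
    rw [neg_mul, Left.neg_nonpos_iff]
    positivity
  · have hcont : Continuous fun ε : ℝ =>
        (Real.exp (-ε * ‖x‖ ^ 2) : ℂ) * fourierInt φ x := by fun_prop
    simpa using (hcont.tendsto 0).mono_left nhdsWithin_le_nhds

lemma integral_exp_mul_smoothedSpectral (hf : IsNonnegDefinite f) (hε : 0 < ε) {t : ℝ}
    (ht : 0 < t) :
    ∫ z, Real.exp (-t * ‖z‖ ^ 2) * smoothedSpectral f ε z =
      gaussMass (E d) t *
        ∫ x, Real.exp (-ε * ‖x‖ ^ 2) * Real.exp (-(1 / (4 * t)) * ‖x‖ ^ 2) ∂f := by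
  have h := hf.integral_mul_smoothedSpectral hε (modulatedGaussian t ht 0)
  rw [← Complex.ofReal_inj, ← integral_complex_ofReal, ← integral_const_mul,
    ← integral_complex_ofReal]
  refine Eq.trans (integral_congr_ae (Eventually.of_forall fun z => ?_))
    (h.trans (integral_congr_ae (Eventually.of_forall fun x => ?_)))
  · dsimp only
    rw [Complex.ofReal_mul, modulatedGaussian_apply]
    simp
  · dsimp only
    rw [fourierInt_modulatedGaussian, add_zero]
    push_cast
    ring

lemma lintegral_exp_mul_smoothedSpectral_le_of_le_one (hf : IsNonnegDefinite f) (hε : 0 < ε)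
    {t : ℝ} (ht : 0 < t) (ht1 : t ≤ 1) :
    ∫⁻ z, ENNReal.ofReal (Real.exp (-t * ‖z‖ ^ 2) * smoothedSpectral f ε z) ≤
      ENNReal.ofReal
        (gaussMass (E d) 1 * (∫ x, Real.exp (-(1 / 4) * ‖x‖ ^ 2) ∂f) * (t ^ d)⁻¹) := by
  have h_integrable :
      Integrable fun z : E d => Real.exp (-t * ‖z‖ ^ 2) * smoothedSpectral f ε z :=
    (integrable_exp_neg_mul_sq_norm volume ht).mul_bdd
      (continuous_smoothedSpectral f hε).aestronglyMeasurable
      (Eventually.of_forall fun z => abs_smoothedSpectral_le f ε z)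
  rw [← ofReal_integral_eq_lintegral_ofReal h_integrable (Eventually.of_forall fun z =>
    mul_nonneg (Real.exp_pos _).le (hf.smoothedSpectral_nonneg hε z)),
    hf.integral_exp_mul_smoothedSpectral hε ht, mul_right_comm]
  refine ENNReal.ofReal_le_ofReal (mul_le_mul ?_ ?_ (by positivity)
    (mul_nonneg (gaussMass_pos one_pos).le (by positivity)))
  · simpa using gaussMass_le_of_le_one (V := E d) ht ht1
  · refine integral_mono_of_nonneg (Eventually.of_forall fun x => by positivity)
      (integrable_exp_neg_mul_sq_norm f (by norm_num)) (Eventually.of_forall fun x => ?_)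
    simp only [← Real.exp_add, Real.exp_le_exp]
    have h1 : 1 / 4 * ‖x‖ ^ 2 ≤ 1 / (4 * t) * ‖x‖ ^ 2 := by
      gcongr
      linarith
    have h2 : 0 ≤ ε * ‖x‖ ^ 2 := by positivity
    linarith

lemma exists_lintegral_exp_mul_smoothedSpectral_le (hf : IsNonnegDefinite f) :
    ∃ K : ℝ, 0 ≤ K ∧ ∀ ε t : ℝ, 0 < ε → 0 < t →
      ∫⁻ z, ENNReal.ofReal (Real.exp (-t * ‖z‖ ^ 2) * smoothedSpectral f ε z) ≤
        ENNReal.ofReal (K * (1 + (t ^ d)⁻¹)) := by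
  have hmass : 0 < gaussMass (E d) 1 := gaussMass_pos one_pos
  refine ⟨gaussMass (E d) 1 * ∫ x, Real.exp (-(1 / 4) * ‖x‖ ^ 2) ∂f, by positivity,
    fun ε t hε ht => ?_⟩
  rcases le_total t 1 with ht1 | ht1
  · refine (hf.lintegral_exp_mul_smoothedSpectral_le_of_le_one hε ht ht1).trans ?_
    gcongr
    linarith
  · calc _ ≤ ∫⁻ z, ENNReal.ofReal (Real.exp (-1 * ‖z‖ ^ 2) * smoothedSpectral f ε z) := by
          refine lintegral_mono fun z => ENNReal.ofReal_le_ofReal ?_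
          have := hf.smoothedSpectral_nonneg hε z
          gcongr
      _ ≤ _ := hf.lintegral_exp_mul_smoothedSpectral_le_of_le_one hε one_pos le_rfl
      _ ≤ _ := by
          gcongr
          simp only [one_pow, inv_one, le_add_iff_nonneg_right]
          positivity

end IsNonnegDefinite

lemma integral_pow_mul_exp_neg_mul_Ioi (n : ℕ) {r : ℝ} (hr : 0 < r) :
    ∫ t in Set.Ioi (0 : ℝ), t ^ n * Real.exp (-(r * t)) = n.factorial * (1 / r) ^ (n + 1) := by
  have h := Real.integral_rpow_mul_exp_neg_mul_Ioi (a := (n : ℝ) + 1) (by positivity) hr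
  rw [add_sub_cancel_right] at h
  simp_rw [Real.rpow_natCast] at h
  rw [h, Real.Gamma_nat_eq_factorial, mul_comm]
  congr 1
  exact_mod_cast Real.rpow_natCast (1 / r) (n + 1)

lemma lintegral_pow_mul_exp_neg_mul_Ioi (n : ℕ) {r : ℝ} (hr : 0 < r) :
    ∫⁻ t in Set.Ioi (0 : ℝ), ENNReal.ofReal (t ^ n * Real.exp (-(r * t))) =
      ENNReal.ofReal (n.factorial * (1 / r) ^ (n + 1)) := by
  rw [← integral_pow_mul_exp_neg_mul_Ioi n hr, ofReal_integral_eq_lintegral_ofReal]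
  · refine not_imp_comm.1 integral_undef ?_
    rw [integral_pow_mul_exp_neg_mul_Ioi n hr]
    positivity
  · filter_upwards [ae_restrict_mem measurableSet_Ioi] with t ht
    have : (0 : ℝ) < t := ht
    positivity

lemma lintegral_pow_mul_exp_mul_exp_mul_Ioi (n : ℕ) {q s : ℝ} (hq : 0 ≤ q) (hs : 0 ≤ s) :
    ∫⁻ t in Set.Ioi (0 : ℝ), ENNReal.ofReal (t ^ n * Real.exp (-t)) *
      ENNReal.ofReal (Real.exp (-t * q) * s) =
      ENNReal.ofReal (n.factorial * ((1 / (1 + q)) ^ (n + 1) * s)) := by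
  have hsplit : ∀ t ∈ Set.Ioi (0 : ℝ), ENNReal.ofReal (t ^ n * Real.exp (-t)) *
      ENNReal.ofReal (Real.exp (-t * q) * s) =
      ENNReal.ofReal s * ENNReal.ofReal (t ^ n * Real.exp (-((1 + q) * t))) := by
    intro t ht
    have ht' : (0 : ℝ) < t := ht
    rw [← ENNReal.ofReal_mul (by positivity), ← ENNReal.ofReal_mul hs]
    have hexp : Real.exp (-((1 + q) * t)) = Real.exp (-t) * Real.exp (-t * q) := by
      rw [← Real.exp_add]
      ring_nf
    rw [hexp]
    ring_nf
  rw [setLIntegral_congr_fun measurableSet_Ioi hsplit, lintegral_const_mul _ (by fun_prop),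
    lintegral_pow_mul_exp_neg_mul_Ioi n (by positivity), ← ENNReal.ofReal_mul hs]
  ring_nf

/-- The smoothed spectral measure, weighted by `(1 + ‖z‖²)^(-k)`. -/
noncomputable def weightedSpectral (f : Measure (E d)) (ε : ℝ) (k : ℕ) : Measure (E d) :=
  volume.withDensity fun z =>
    ENNReal.ofReal ((1 / (1 + ‖z‖ ^ 2)) ^ k * smoothedSpectral f ε z)

lemma weightedSpectral_succ (f : Measure (E d)) [f.HasTemperateGrowth] {ε : ℝ} (hε : 0 < ε)
    (k : ℕ) : weightedSpectral f ε (k + 1) =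
      (weightedSpectral f ε k).withDensity fun z => ENNReal.ofReal (1 / (1 + ‖z‖ ^ 2)) := by
  have hcont := continuous_smoothedSpectral f hε
  rw [weightedSpectral, weightedSpectral, ← withDensity_mul _ (by fun_prop) (by fun_prop)]
  congr 1
  funext z
  rw [Pi.mul_apply, ← ENNReal.ofReal_mul' (by positivity), pow_succ, mul_right_comm]

namespace IsNonnegDefinite

variable {f : Measure (E d)} {ε : ℝ} [f.HasTemperateGrowth]

-- Subordination: `d! (1 + ‖z‖²)^(-(d+1))` is the mixture `∫ t^d e^{-t} e^{-t ‖z‖²} dt` of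
-- Gaussians.
lemma exists_weightedSpectral_univ_le (hf : IsNonnegDefinite f) :
    ∃ C : ℝ≥0, ∀ ε : ℝ, 0 < ε → weightedSpectral f ε (d + 1) Set.univ ≤ C := by
  obtain ⟨K, hK, hbound⟩ := hf.exists_lintegral_exp_mul_smoothedSpectral_le
  refine ⟨(K * (d.factorial + 1)).toNNReal, fun ε hε => ?_⟩
  have hcont := continuous_smoothedSpectral f hε
  rw [weightedSpectral, withDensity_apply _ MeasurableSet.univ, Measure.restrict_univ]
  calc ∫⁻ z : E d, ENNReal.ofReal ((1 / (1 + ‖z‖ ^ 2)) ^ (d + 1) * smoothedSpectral f ε z)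
      ≤ ∫⁻ z : E d, ∫⁻ t in Set.Ioi (0 : ℝ), ENNReal.ofReal (t ^ d * Real.exp (-t)) *
          ENNReal.ofReal (Real.exp (-t * ‖z‖ ^ 2) * smoothedSpectral f ε z) := by
        refine lintegral_mono fun z => ?_
        have hnn := hf.smoothedSpectral_nonneg hε z
        rw [lintegral_pow_mul_exp_mul_exp_mul_Ioi d (sq_nonneg _) hnn]
        refine ENNReal.ofReal_le_ofReal (le_mul_of_one_le_left (by positivity) ?_)
        exact_mod_cast Nat.one_le_iff_ne_zero.2 (Nat.factorial_ne_zero d)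
    _ = ∫⁻ t in Set.Ioi (0 : ℝ), ∫⁻ z : E d, ENNReal.ofReal (t ^ d * Real.exp (-t)) *
          ENNReal.ofReal (Real.exp (-t * ‖z‖ ^ 2) * smoothedSpectral f ε z) := by
        refine lintegral_lintegral_swap (Measurable.aemeasurable ?_)
        have := hcont.measurable
        simp only [Function.uncurry_def]
        fun_prop
    _ ≤ ∫⁻ t in Set.Ioi (0 : ℝ), ENNReal.ofReal K * (ENNReal.ofReal (t ^ d * Real.exp (-(1 * t))) +
          ENNReal.ofReal (t ^ 0 * Real.exp (-(1 * t)))) := by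
        refine setLIntegral_mono' measurableSet_Ioi fun t ht => ?_
        have ht' : (0 : ℝ) < t := ht
        rw [lintegral_const_mul _ (by fun_prop)]
        refine (mul_le_mul_right (hbound ε t hε ht') _).trans_eq ?_
        rw [← ENNReal.ofReal_add (by positivity) (by positivity),
          ← ENNReal.ofReal_mul (by positivity), ← ENNReal.ofReal_mul hK]
        congr 1
        field_simp
    _ = _ := by
        rw [lintegral_const_mul _ (by fun_prop), lintegral_add_left (by fun_prop),
          lintegral_pow_mul_exp_neg_mul_Ioi d one_pos, lintegral_pow_mul_exp_neg_mul_Ioi 0 one_pos,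
          ← ENNReal.ofReal_add (by positivity) (by positivity), ← ENNReal.ofReal_mul hK]
        simp [ENNReal.ofReal]

lemma integral_weightedSpectral (hf : IsNonnegDefinite f) (hε : 0 < ε) (k : ℕ) (φ : E d → ℂ) :
    ∫ z, ((1 + ‖z‖ ^ 2) ^ k : ℝ) * φ z ∂(weightedSpectral f ε k) =
      ∫ z, φ z * smoothedSpectral f ε z := by
  have hcont := continuous_smoothedSpectral f hε
  rw [weightedSpectral, integral_withDensity_eq_integral_toReal_smul _ (by simp)]
  · refine integral_congr_ae (Eventually.of_forall fun z => ?_)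
    dsimp only
    have hz : 1 + ‖z‖ ^ 2 ≠ 0 := by positivity
    rw [ENNReal.toReal_ofReal (mul_nonneg (by positivity) (hf.smoothedSpectral_nonneg hε z)),
      Complex.real_smul, ← mul_assoc, ← Complex.ofReal_mul, mul_right_comm, ← mul_pow,
      one_div_mul_cancel hz, one_pow, one_mul, mul_comm]
  · have := hcont.measurable
    fun_prop

/-- The Bochner–Schwartz theorem. -/
theorem exists_isFourierTransform (hf : IsNonnegDefinite f) :
    ∃ ν : Measure (E d), ν.HasTemperateGrowth ∧ IsFourierTransform f ν := by
  obtain ⟨C, hC⟩ := hf.exists_weightedSpectral_univ_le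
  let ε (n : ℕ) : ℝ := 1 / (n + 1)
  have hε (n : ℕ) : 0 < ε n := by positivity
  have hsucc (n : ℕ) := weightedSpectral_succ f (hε n) (d + 1)
  let μ (n : ℕ) : FiniteMeasure (E d) := ⟨weightedSpectral f (ε n) (d + 2), ⟨by
    rw [hsucc]
    exact ((withDensity_one_div_univ_le _).trans (hC _ (hε n))).trans_lt ENNReal.coe_lt_top⟩⟩
  obtain ⟨μ', hlim⟩ := exists_tendsto_withDensity_one_div (hyperfilter ℕ) (μ := μ)
    (fun n => hC (ε n) (hε n)) hsucc
  rw [FiniteMeasure.tendsto_iff_forall_integral_rclike_tendsto ℂ] at hlim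
  let w (z : E d) : ℝ := (1 + ‖z‖ ^ 2) ^ (d + 2)
  have hw : (fun z : E d => (w z : ℂ)).HasTemperateGrowth := by fun_prop
  refine ⟨(μ' : Measure (E d)).withDensity fun z => ENNReal.ofReal (w z),
    hasTemperateGrowth_withDensity_one_add_sq_pow _ _, fun φ => ?_⟩
  have hμ' : Tendsto (fun n => ∫ z, w z * φ z ∂(μ n : Measure (E d))) (hyperfilter ℕ)
      (𝓝 (∫ z, w z * φ z ∂(μ' : Measure (E d)))) := by
    simpa only [SchwartzMap.toBoundedContinuousFunction_apply,
      SchwartzMap.smulLeftCLM_apply_apply hw, smul_eq_mul] using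
      hlim (SchwartzMap.smulLeftCLM ℂ (fun z => (w z : ℂ)) φ).toBoundedContinuousFunction
  have hε0 : Tendsto ε (hyperfilter ℕ) (𝓝[>] 0) :=
    tendsto_nhdsWithin_iff.2 ⟨tendsto_one_div_add_atTop_nhds_zero_nat.mono_left
      Nat.hyperfilter_le_atTop, Eventually.of_forall hε⟩
  have hsmooth := (hf.tendsto_integral_mul_smoothedSpectral φ).comp hε0
  rw [← tendsto_nhds_unique
    (hμ'.congr fun n => hf.integral_weightedSpectral (hε n) (d + 2) φ) hsmooth,
    integral_withDensity_eq_integral_toReal_smul (by fun_prop) (by simp)]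
  refine integral_congr_ae (Eventually.of_forall fun z => ?_)
  simp only [w]
  rw [ENNReal.toReal_ofReal (by positivity), Complex.real_smul]

lemma spectralMeasure_spec (hf : IsNonnegDefinite f) :
    (spectralMeasure f).HasTemperateGrowth ∧ IsFourierTransform f (spectralMeasure f) := by
  rw [spectralMeasure, dif_pos hf.exists_isFourierTransform]
  exact hf.exists_isFourierTransform.choose_spec

end IsNonnegDefinite

namespace IsFourierTransform

variable {f ν : Measure (E d)} {b : ℝ}

lemma integral_cexp_eq (hν : IsFourierTransform f ν) (hb : 0 < b) (u : E d) :
    ∫ z, Complex.exp (-b * ‖z‖ ^ 2 + I * (inner ℝ u z : ℝ)) ∂ν =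
      ((gaussMass (E d) b * ∫ x, Real.exp (-(1 / (4 * b)) * ‖x + u‖ ^ 2) ∂f : ℝ) : ℂ) := by
  have h := hν (modulatedGaussian b hb u)
  simp_rw [fourierInt_modulatedGaussian, modulatedGaussian_apply] at h
  rw [h, ← integral_const_mul, ← integral_complex_ofReal]

lemma gaussMass_mul_integral_le (hν : IsFourierTransform f ν) (hb : 0 < b) (u : E d) :
    gaussMass (E d) b * ∫ x, Real.exp (-(1 / (4 * b)) * ‖x + u‖ ^ 2) ∂f ≤
      ∫ z, Real.exp (-b * ‖z‖ ^ 2) ∂ν := by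
  refine (le_abs_self _).trans ?_
  rw [← Real.norm_eq_abs, ← Complex.norm_real, ← hν.integral_cexp_eq hb u]
  refine (norm_integral_le_integral_norm _).trans_eq ?_
  simp_rw [norm_cexp_neg_mul_sq_norm_add_I_mul]

lemma lintegral_gauss_sub_le [f.HasTemperateGrowth] (hν : IsFourierTransform f ν) (hb : 0 < b)
    (u : E d) :
    ∫⁻ x, ENNReal.ofReal (gaussMass (E d) b * Real.exp (-(1 / (4 * b)) * ‖u - x‖ ^ 2)) ∂f ≤
      ENNReal.ofReal (∫ z, Real.exp (-b * ‖z‖ ^ 2) ∂ν) := by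
  have hmass : 0 < gaussMass (E d) b := gaussMass_pos hb
  have hb' : 0 < 1 / (4 * b) := by positivity
  have h_integrable : Integrable (fun x => Real.exp (-(1 / (4 * b)) * ‖u - x‖ ^ 2)) f := by
    refine ((SchwartzMap.compSubConstCLM ℝ u (gaussianSchwartz (1 / (4 * b)) hb')).integrable
      (μ := f)).congr (Eventually.of_forall fun x => ?_)
    simp only [SchwartzMap.compSubConstCLM_apply, gaussianSchwartz_apply, norm_sub_rev]
  rw [← ofReal_integral_eq_lintegral_ofReal (h_integrable.const_mul _)
    (Eventually.of_forall fun z => by positivity), integral_const_mul]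
  simpa [← sub_eq_add_neg, norm_sub_rev] using
    ENNReal.ofReal_le_ofReal (hν.gaussMass_mul_integral_le hb (-u))

end IsFourierTransform

section Atom

variable {V : Type*} [NormedAddCommGroup V] [InnerProductSpace ℝ V] [MeasurableSpace V]
  [BorelSpace V] [SecondCountableTopology V]

lemma tendsto_integral_cexp_atTop (ν : Measure V) [ν.HasTemperateGrowth] (u : V) :
    Tendsto (fun b : ℝ => ∫ z, Complex.exp (-b * ‖z‖ ^ 2 + I * (inner ℝ u z : ℝ)) ∂ν) atTop
      (𝓝 (ν.real {0})) := by
  have hatom : ∫ z, Set.indicator {(0 : V)} (fun _ => (1 : ℂ)) z ∂ν = ν.real {0} := by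
    rw [integral_indicator_const _ (measurableSet_singleton 0)]
    simp
  rw [← hatom]
  refine tendsto_integral_filter_of_dominated_convergence (fun z => Real.exp (-1 * ‖z‖ ^ 2))
    (Eventually.of_forall fun b => Continuous.aestronglyMeasurable (by fun_prop))
    ((eventually_ge_atTop 1).mono fun b hb => Eventually.of_forall fun z => ?_)
    (integrable_exp_neg_mul_sq_norm ν one_pos) (Eventually.of_forall fun z => ?_)
  · rw [norm_cexp_neg_mul_sq_norm_add_I_mul]
    gcongr
  · rcases eq_or_ne z 0 with rfl | hz
    · simp
    · rw [Set.indicator_of_notMem (by simpa using hz), tendsto_zero_iff_norm_tendsto_zero]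
      simp_rw [norm_cexp_neg_mul_sq_norm_add_I_mul]
      have hz' : 0 < ‖z‖ ^ 2 := by positivity
      exact Real.tendsto_exp_atBot.comp (tendsto_neg_atTop_atBot.atBot_mul_const hz')

lemma tendsto_integral_rexp_atTop (ν : Measure V) [ν.HasTemperateGrowth] :
    Tendsto (fun b : ℝ => ∫ z, Real.exp (-b * ‖z‖ ^ 2) ∂ν) atTop (𝓝 (ν.real {0})) := by
  have h := (Complex.continuous_re.tendsto _).comp (tendsto_integral_cexp_atTop ν 0)
  refine h.congr fun b => ?_
  rw [Function.comp_apply, ← Complex.ofReal_re (∫ z, Real.exp (-b * ‖z‖ ^ 2) ∂ν),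
    ← integral_complex_ofReal]
  simp

end Atom

section DensityOne

variable {X ι : Type*} [MeasurableSpace X]

/-- The sets whose complement has mass tending to `0` along a family of measures. For probability
measures of ever wider range, these are sets of asymptotic density one; convergence in mean implies
convergence along this filter. -/
def densityOneFilter (γ : ι → Measure X) (l : Filter ι) : Filter X where
  sets := {s | Tendsto (fun i => γ i sᶜ) l (𝓝 0)}
  univ_sets := by simpa using tendsto_const_nhds
  sets_of_superset hs hst := tendsto_of_tendsto_of_tendsto_of_le_of_le tendsto_const_nhds hs
    (fun _ => zero_le) fun _ => measure_mono (Set.compl_subset_compl.2 hst)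
  inter_sets {s t} hs ht := by
    refine tendsto_of_tendsto_of_tendsto_of_le_of_le tendsto_const_nhds
      (by simpa using Tendsto.add hs ht) (fun _ => zero_le) fun i => ?_
    rw [Set.compl_inter]
    exact measure_union_le _ _

lemma densityOneFilter_neBot {γ : ι → Measure X} {l : Filter ι}
    (h : ¬ Tendsto (fun i => γ i Set.univ) l (𝓝 0)) : (densityOneFilter γ l).NeBot := by
  refine ⟨fun hbot => h ?_⟩
  have hempty : ∅ ∈ densityOneFilter γ l := hbot ▸ mem_bot
  simpa using show Tendsto (fun i => γ i ∅ᶜ) l (𝓝 0) from hempty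

lemma tendsto_zero_densityOneFilter {γ : ι → Measure X} {l : Filter ι} {g : X → ℝ≥0∞}
    (hg : Measurable g) (h : Tendsto (fun i => ∫⁻ x, g x ∂(γ i)) l (𝓝 0)) :
    Tendsto g (densityOneFilter γ l) (𝓝 0) := by
  refine ENNReal.tendsto_nhds_zero.2 fun ε hε => ?_
  rcases eq_or_ne ε ∞ with rfl | hε'
  · simp
  have hmarkov : Tendsto (fun i => (∫⁻ x, g x ∂(γ i)) / ε) l (𝓝 0) := by
    simpa using ENNReal.Tendsto.div_const h (Or.inr hε.ne')
  refine tendsto_of_tendsto_of_tendsto_of_le_of_le tendsto_const_nhds hmarkov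
    (fun _ => zero_le) fun i => ?_
  refine (measure_mono fun x hx => ?_).trans (meas_ge_le_lintegral_div hg.aemeasurable hε.ne' hε')
  exact (not_le.1 (by simpa using hx)).le

end DensityOne

section Convolution

variable {A : Type*} [AddCommGroup A] [MeasurableSpace A] [MeasurableAdd₂ A] [MeasurableNeg A]
  {μ f : Measure A} [SFinite μ] [SFinite f]

lemma measurable_lintegral_mul_lintegral_sub {φ ψ : A → ℝ≥0∞} (hφ : Measurable φ)
    (hψ : Measurable ψ) : Measurable fun y => ∫⁻ x, φ x * ∫⁻ z, ψ (x - z - y) ∂f ∂μ := by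
  have hψ' : Measurable fun p : (A × A) × A => ψ (p.1.2 - p.2 - p.1.1) := by fun_prop
  have hinner : Measurable fun p : A × A => ∫⁻ z, ψ (p.2 - z - p.1) ∂f :=
    hψ'.lintegral_prod_right'
  exact ((hφ.comp measurable_snd).mul hinner).lintegral_prod_right'

variable [μ.IsAddLeftInvariant] [μ.IsNegInvariant] {g : A → ℝ≥0∞} {N : ℝ≥0∞}

lemma lintegral_mul_lintegral_sub_le {ψ : A → ℝ≥0∞} (hg : Measurable g) (hψ : Measurable ψ)
    (hN : ∀ u, ∫⁻ z, g (u - z) ∂f ≤ N) (x : A) :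
    ∫⁻ y, g y * ∫⁻ z, ψ (x - z - y) ∂f ∂μ ≤ (∫⁻ w, ψ w ∂μ) * N :=
  calc ∫⁻ y, g y * ∫⁻ z, ψ (x - z - y) ∂f ∂μ
      = ∫⁻ y, ∫⁻ z, g y * ψ (x - z - y) ∂f ∂μ := by
        refine lintegral_congr fun y => ?_
        rw [lintegral_const_mul _ (by fun_prop)]
    _ = ∫⁻ z, ∫⁻ y, g y * ψ (x - z - y) ∂μ ∂f := lintegral_lintegral_swap (by fun_prop)
    _ = ∫⁻ z, ∫⁻ w, g (x - w - z) * ψ w ∂μ ∂f := by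
        refine lintegral_congr fun z => ?_
        rw [← lintegral_sub_left_eq_self _ (x - z)]
        refine lintegral_congr fun w => ?_
        rw [sub_sub_cancel, sub_right_comm]
    _ = ∫⁻ w, ∫⁻ z, g (x - w - z) * ψ w ∂f ∂μ := lintegral_lintegral_swap (by fun_prop)
    _ ≤ ∫⁻ w, ψ w * N ∂μ := by
        refine lintegral_mono fun w => ?_
        dsimp only
        rw [lintegral_mul_const _ (by fun_prop), mul_comm]
        exact mul_le_mul_right (hN (x - w)) _
    _ = _ := lintegral_mul_const _ (by fun_prop)

lemma lintegral_mul_lintegral_mul_lintegral_sub_le {φ ψ : A → ℝ≥0∞} (hg : Measurable g)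
    (hφ : Measurable φ) (hψ : Measurable ψ) (hN : ∀ u, ∫⁻ z, g (u - z) ∂f ≤ N) :
    ∫⁻ y, g y * ∫⁻ x, φ x * ∫⁻ z, ψ (x - z - y) ∂f ∂μ ∂μ ≤
      (∫⁻ x, φ x ∂μ) * (∫⁻ x, ψ x ∂μ) * N := by
  have hψ' : Measurable fun p : (A × A) × A => ψ (p.1.2 - p.2 - p.1.1) := by fun_prop
  have hinner : Measurable fun p : A × A => ∫⁻ z, ψ (p.2 - z - p.1) ∂f :=
    hψ'.lintegral_prod_right'
  have hinner₁ (y : A) : Measurable fun x => ∫⁻ z, ψ (x - z - y) ∂f :=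
    hinner.comp (measurable_const.prodMk measurable_id)
  have hinner₂ (x : A) : Measurable fun y => ∫⁻ z, ψ (x - z - y) ∂f :=
    hinner.comp (measurable_id.prodMk measurable_const)
  calc ∫⁻ y, g y * ∫⁻ x, φ x * ∫⁻ z, ψ (x - z - y) ∂f ∂μ ∂μ
      = ∫⁻ y, ∫⁻ x, g y * (φ x * ∫⁻ z, ψ (x - z - y) ∂f) ∂μ ∂μ := by
        refine lintegral_congr fun y => ?_
        have h_measurable : Measurable fun x => φ x * ∫⁻ z, ψ (x - z - y) ∂f :=
          hφ.mul (hinner₁ y)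
        rw [lintegral_const_mul _ h_measurable]
    _ = ∫⁻ x, ∫⁻ y, g y * (φ x * ∫⁻ z, ψ (x - z - y) ∂f) ∂μ ∂μ :=
        lintegral_lintegral_swap (Measurable.aemeasurable
          ((hg.comp measurable_fst).mul ((hφ.comp measurable_snd).mul hinner)))
    _ ≤ ∫⁻ x, φ x * ((∫⁻ w, ψ w ∂μ) * N) ∂μ := by
        refine lintegral_mono fun x => ?_
        have h_measurable : Measurable fun y => g y * ∫⁻ z, ψ (x - z - y) ∂f :=
          hg.mul (hinner₂ x)
        simp_rw [mul_left_comm _ (φ x)]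
        rw [lintegral_const_mul _ h_measurable]
        exact mul_le_mul_right (lintegral_mul_lintegral_sub_le hg hψ hN x) _
    _ = _ := by rw [lintegral_mul_const _ (by fun_prop), mul_assoc]

end Convolution

section WideGaussian

variable {V : Type*} [NormedAddCommGroup V] [InnerProductSpace ℝ V] [MeasurableSpace V]
  [BorelSpace V] [FiniteDimensional ℝ V]

variable (V) in
/-- A Gaussian measure of total mass `(2π) ^ dim V` and covariance `2 b` times the identity; its
density is the Fourier transform of `exp (-b ‖z‖²)`. -/
noncomputable def wideGaussian (b : ℝ) : Measure V :=
  volume.withDensity fun y =>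
    ENNReal.ofReal (gaussMass V b * Real.exp (-(1 / (4 * b)) * ‖y‖ ^ 2))

lemma wideGaussian_univ {b : ℝ} (hb : 0 < b) :
    wideGaussian V b Set.univ = ENNReal.ofReal ((2 * Real.pi) ^ Module.finrank ℝ V) := by
  have hb' : 0 < 1 / (4 * b) := by positivity
  have hmass : 0 < gaussMass V b := gaussMass_pos hb
  rw [wideGaussian, withDensity_apply _ MeasurableSet.univ, Measure.restrict_univ,
    ← ofReal_integral_eq_lintegral_ofReal
      ((integrable_exp_neg_mul_sq_norm volume hb').const_mul _)
      (Eventually.of_forall fun y => by positivity), integral_const_mul,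
    ← gaussMass_mul_gaussMass_inv_four_mul hb]
  simpa using congrArg (fun m => ENNReal.ofReal (gaussMass V b * m))
    (integral_rexp_neg_mul_sq_norm_add (V := V) hb' 0 0)

variable (V) in
instance densityOneFilter_wideGaussian_neBot :
    (densityOneFilter (wideGaussian V) atTop).NeBot := by
  refine densityOneFilter_neBot fun h => ?_
  have hconst : Tendsto (fun b => wideGaussian V b Set.univ) atTop
      (𝓝 (ENNReal.ofReal ((2 * Real.pi) ^ Module.finrank ℝ V))) :=
    tendsto_const_nhds.congr' ((eventually_gt_atTop 0).mono fun b hb => (wideGaussian_univ hb).symm)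
  have hzero := tendsto_nhds_unique hconst h
  rw [ENNReal.ofReal_eq_zero] at hzero
  exact absurd hzero (not_le.2 (pow_pos Real.two_pi_pos _))

/-- The spatial covariance `⟨φ, ψ * f⟩`. -/
noncomputable def pairing (f : Measure V) (φ ψ : 𝓢(V, ℝ)) : ℝ :=
  ∫ x, φ x * (∫ y, ψ (x - y) ∂f)

lemma enorm_pairing_translate_le (f : Measure V) (φ ψ : 𝓢(V, ℝ)) (y : V) :
    ‖pairing f φ (SchwartzMap.compSubConstCLM ℝ y ψ)‖ₑ ≤
      ∫⁻ x, ‖φ x‖ₑ * ∫⁻ z, ‖ψ (x - z - y)‖ₑ ∂f := by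
  refine (enorm_integral_le_lintegral_enorm _).trans (lintegral_mono fun x => ?_)
  rw [enorm_mul]
  gcongr
  exact enorm_integral_le_lintegral_enorm _

lemma pairing_translate_translate (f : Measure V) (φ ψ : 𝓢(V, ℝ)) (y : V) :
    pairing f (SchwartzMap.compSubConstCLM ℝ y φ) (SchwartzMap.compSubConstCLM ℝ y ψ) =
      pairing f φ ψ := by
  simp only [pairing, SchwartzMap.compSubConstCLM_apply, sub_right_comm _ _ y]
  exact integral_sub_right_eq_self (fun x => φ x * ∫ z, ψ (x - z) ∂f) y

end WideGaussian

theorem IsFourierTransform.tendsto_pairing_translate {f ν : Measure (E d)} [f.HasTemperateGrowth]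
    [ν.HasTemperateGrowth] (hν : IsFourierTransform f ν) (hatom : ν {0} = 0) (φ ψ : 𝓢(E d, ℝ)) :
    Tendsto (fun y => pairing f φ (SchwartzMap.compSubConstCLM ℝ y ψ))
      (densityOneFilter (wideGaussian (E d)) atTop) (𝓝 0) := by
  have := sigmaFinite_of_hasTemperateGrowth f
  let g (y : E d) : ℝ≥0∞ := ∫⁻ x, ‖φ x‖ₑ * ∫⁻ z, ‖ψ (x - z - y)‖ₑ ∂f
  have hφ := φ.continuous.measurable.enorm
  have hψ := ψ.continuous.measurable.enorm
  have hg : Measurable g := measurable_lintegral_mul_lintegral_sub hφ hψ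
  let S : ℝ≥0∞ := (∫⁻ x, ‖φ x‖ₑ) * ∫⁻ x, ‖ψ x‖ₑ
  have hS : S ≠ ∞ := (ENNReal.mul_lt_top φ.integrable.2 ψ.integrable.2).ne
  have hbound (b : ℝ) (hb : 0 < b) : ∫⁻ y, g y ∂(wideGaussian (E d) b) ≤
      S * ENNReal.ofReal (∫ z, Real.exp (-b * ‖z‖ ^ 2) ∂ν) := by
    rw [wideGaussian, lintegral_withDensity_eq_lintegral_mul _ (by fun_prop) hg]
    exact lintegral_mul_lintegral_mul_lintegral_sub_le (by fun_prop) hφ hψ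
      (hν.lintegral_gauss_sub_le hb)
  have hlim : Tendsto (fun b : ℝ => S * ENNReal.ofReal (∫ z, Real.exp (-b * ‖z‖ ^ 2) ∂ν)) atTop
      (𝓝 0) := by
    have h := ENNReal.tendsto_ofReal (tendsto_integral_rexp_atTop ν)
    simpa [measureReal_def, hatom] using ENNReal.Tendsto.const_mul h (Or.inr hS)
  have hmean : Tendsto (fun b => ∫⁻ y, g y ∂(wideGaussian (E d) b)) atTop (𝓝 0) :=
    tendsto_of_tendsto_of_tendsto_of_le_of_le' tendsto_const_nhds hlim
      (Eventually.of_forall fun _ => zero_le) ((eventually_gt_atTop 0).mono hbound)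
  rw [tendsto_zero_iff_enorm_tendsto_zero]
  exact tendsto_of_tendsto_of_tendsto_of_le_of_le tendsto_const_nhds
    (tendsto_zero_densityOneFilter hg hmean) (fun _ => zero_le)
    fun y => enorm_pairing_translate_le f φ ψ y

lemma min_div_four_mul_sq_norm_add_le {V : Type*} [SeminormedAddCommGroup V] {b c : ℝ}
    (hb : 0 < b) (hc : 0 < c) (x w : V) :
    min b c / 2 * ‖x‖ ^ 2 + min b c / 4 * ‖w‖ ^ 2 ≤ b * ‖x‖ ^ 2 + c * ‖x - w‖ ^ 2 := by
  set m := min b c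
  have hm : 0 < m := lt_min hb hc
  have hw : ‖w‖ ^ 2 ≤ 2 * ‖x‖ ^ 2 + 2 * ‖x - w‖ ^ 2 := by
    have htri : ‖w‖ ≤ ‖x‖ + ‖x - w‖ := by simpa using norm_sub_le x (x - w)
    have hsq : ‖w‖ ^ 2 ≤ (‖x‖ + ‖x - w‖) ^ 2 := by gcongr
    linarith [two_mul_le_add_sq ‖x‖ ‖x - w‖, add_sq ‖x‖ ‖x - w‖]
  have hmb : m * ‖x‖ ^ 2 ≤ b * ‖x‖ ^ 2 := by gcongr; exact min_le_left _ _
  have hmc : m * ‖x - w‖ ^ 2 ≤ c * ‖x - w‖ ^ 2 := by gcongr; exact min_le_right _ _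
  nlinarith [mul_le_mul_of_nonneg_left hw hm.le, mul_nonneg hm.le (sq_nonneg ‖x - w‖)]

section GaussianDensity

variable {V : Type*} [NormedAddCommGroup V] [InnerProductSpace ℝ V]

lemma gaussMass_mul_gaussMass_eq_gaussMass_add_mul {b c : ℝ} (hb : 0 < b) (hc : 0 < c) :
    gaussMass V b * gaussMass V c = gaussMass V (b + c) * gaussMass V (b * c / (b + c)) := by
  unfold gaussMass
  rw [← Real.mul_rpow (by positivity) (by positivity),
    ← Real.mul_rpow (by positivity) (by positivity)]
  congr 1
  field_simp

variable (V) in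
/-- The Gaussian probability density whose Fourier transform is `exp (-a ‖z‖²)`. -/
noncomputable def gaussDensity (a : ℝ) (ha : 0 < a) : 𝓢(V, ℝ) :=
  (gaussMass V (1 / (4 * a)))⁻¹ • gaussianSchwartz (1 / (4 * a)) (by positivity)

variable [MeasurableSpace V] [BorelSpace V] [FiniteDimensional ℝ V]

lemma integral_exp_mul_exp_sub {b c : ℝ} (hb : 0 < b) (hc : 0 < c) (w : V) :
    ∫ x : V, Real.exp (-b * ‖x‖ ^ 2) * Real.exp (-c * ‖x - w‖ ^ 2) =
      gaussMass V (b + c) * Real.exp (-(b * c / (b + c)) * ‖w‖ ^ 2) := by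
  have hsquare (x : V) : Real.exp (-b * ‖x‖ ^ 2) * Real.exp (-c * ‖x - w‖ ^ 2) =
      Real.exp (-c * ‖w‖ ^ 2) * Real.exp (-(b + c) * ‖x‖ ^ 2 + (2 * c) * inner ℝ w x) := by
    rw [← Real.exp_add, ← Real.exp_add, norm_sub_sq_real, real_inner_comm]
    ring_nf
  simp_rw [hsquare]
  rw [integral_const_mul, integral_rexp_neg_mul_sq_norm_add (by positivity), mul_left_comm,
    ← Real.exp_add]
  congr 2
  field_simp
  ring

lemma integrable_exp_mul_exp_sub_sub (f : Measure V) [f.HasTemperateGrowth] {b c : ℝ}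
    (hb : 0 < b) (hc : 0 < c) (y : V) :
    Integrable (fun p : V × V =>
      Real.exp (-b * ‖p.1‖ ^ 2) * Real.exp (-c * ‖p.1 - p.2 - y‖ ^ 2)) (volume.prod f) := by
  have := sigmaFinite_of_hasTemperateGrowth f
  have hm : 0 < min b c := lt_min hb hc
  have hfst : Integrable (fun x : V => Real.exp (-(min b c / 2) * ‖x‖ ^ 2)) volume :=
    integrable_exp_neg_mul_sq_norm volume (half_pos hm)
  have hsnd : Integrable (fun z : V => Real.exp (-(min b c / 4) * ‖z + y‖ ^ 2)) f := by
    refine ((SchwartzMap.compSubConstCLM ℝ (-y)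
      (gaussianSchwartz (min b c / 4) (by positivity))).integrable (μ := f)).congr
      (Eventually.of_forall fun z => ?_)
    simp only [SchwartzMap.compSubConstCLM_apply, gaussianSchwartz_apply, sub_neg_eq_add]
  refine (hfst.mul_prod hsnd).mono' (Continuous.aestronglyMeasurable (by fun_prop))
    (Eventually.of_forall fun p => ?_)
  rw [Real.norm_eq_abs, abs_mul, Real.abs_exp, Real.abs_exp, ← Real.exp_add, ← Real.exp_add,
    Real.exp_le_exp, sub_sub]
  linarith [min_div_four_mul_sq_norm_add_le hb hc p.1 (p.2 + y)]

lemma integral_exp_mul_integral_exp_sub_sub (f : Measure V) [f.HasTemperateGrowth] {b c : ℝ}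
    (hb : 0 < b) (hc : 0 < c) (y : V) :
    ∫ x : V, Real.exp (-b * ‖x‖ ^ 2) * ∫ z, Real.exp (-c * ‖x - z - y‖ ^ 2) ∂f =
      gaussMass V (b + c) * ∫ z, Real.exp (-(b * c / (b + c)) * ‖z + y‖ ^ 2) ∂f := by
  have := sigmaFinite_of_hasTemperateGrowth f
  simp_rw [← integral_const_mul]
  rw [integral_integral_swap (integrable_exp_mul_exp_sub_sub f hb hc y)]
  refine integral_congr_ae (Eventually.of_forall fun z => ?_)
  simp only [sub_sub]
  exact integral_exp_mul_exp_sub hb hc (z + y)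

end GaussianDensity

lemma IsFourierTransform.pairing_gaussDensity_translate {f ν : Measure (E d)}
    [f.HasTemperateGrowth] (hν : IsFourierTransform f ν) {a a' : ℝ} (ha : 0 < a) (ha' : 0 < a')
    (y : E d) :
    pairing f (gaussDensity (E d) a ha)
        (SchwartzMap.compSubConstCLM ℝ y (gaussDensity (E d) a' ha')) =
      ((2 * Real.pi) ^ d)⁻¹ *
        (∫ z, Complex.exp (-(a + a' : ℝ) * ‖z‖ ^ 2 + I * (inner ℝ y z : ℝ)) ∂ν).re := by
  set b := 1 / (4 * a) with hb_def
  set c := 1 / (4 * a') with hc_def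
  have hb : 0 < b := by positivity
  have hc : 0 < c := by positivity
  have hbc : b * c / (b + c) = 1 / (4 * (a + a')) := by
    rw [hb_def, hc_def]
    field_simp
    ring
  have hpairing : pairing f (gaussDensity (E d) a ha)
      (SchwartzMap.compSubConstCLM ℝ y (gaussDensity (E d) a' ha')) =
      (gaussMass (E d) b * gaussMass (E d) c)⁻¹ *
        (gaussMass (E d) (b + c) * ∫ z, Real.exp (-(1 / (4 * (a + a'))) * ‖z + y‖ ^ 2) ∂f) := by
    rw [← hbc, ← integral_exp_mul_integral_exp_sub_sub f hb hc, ← integral_const_mul]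
    refine integral_congr_ae (Eventually.of_forall fun x => ?_)
    simp only [gaussDensity, SchwartzMap.compSubConstCLM_apply, smul_apply,
      gaussianSchwartz_apply, smul_eq_mul, integral_const_mul, ← hb_def, ← hc_def]
    ring
  have hmass := gaussMass_mul_gaussMass_inv_four_mul (V := E d) (show 0 < a + a' by positivity)
  rw [finrank_euclideanSpace_fin] at hmass
  have hpos (t : ℝ) (ht : 0 < t) : gaussMass (E d) t ≠ 0 := (gaussMass_pos ht).ne'
  have hmass_add := hpos (b + c) (by positivity)
  have hmass_freq := hpos (a + a') (by positivity)
  have hmass_dual := hpos (1 / (4 * (a + a'))) (by positivity)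
  rw [hpairing, hν.integral_cexp_eq (by positivity), Complex.ofReal_re, ← hmass,
    gaussMass_mul_gaussMass_eq_gaussMass_add_mul hb hc, hbc]
  field_simp

section WeakConvergence

variable {𝕜 H Y : Type*} [RCLike 𝕜] [NormedAddCommGroup H] [InnerProductSpace 𝕜 H]
  {l : Filter Y} {z : Y → H} {C : ℝ}

lemma tendsto_inner_zero_of_mem_closure {S : Set H} (hbound : ∀ y, ‖z y‖ ≤ C)
    (hS : ∀ v ∈ S, Tendsto (fun y => inner 𝕜 v (z y)) l (𝓝 0)) {v : H} (hv : v ∈ closure S) :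
    Tendsto (fun y => inner 𝕜 v (z y)) l (𝓝 0) := by
  refine Metric.tendsto_nhds.2 fun ε hε => ?_
  have hC : 0 < |C| + 1 := by positivity
  obtain ⟨w, hwS, hvw⟩ := Metric.mem_closure_iff.1 hv (ε / 2 / (|C| + 1)) (by positivity)
  filter_upwards [Metric.tendsto_nhds.1 (hS w hwS) (ε / 2) (by positivity)] with y hy
  rw [dist_zero_right] at hy ⊢
  have hdiff : ‖inner 𝕜 (v - w) (z y)‖ ≤ ε / 2 :=
    calc ‖inner 𝕜 (v - w) (z y)‖ ≤ ‖v - w‖ * ‖z y‖ := norm_inner_le_norm _ _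
      _ ≤ ε / 2 / (|C| + 1) * (|C| + 1) := by
        gcongr
        · exact (dist_eq_norm v w ▸ hvw).le
        · linarith [hbound y, le_abs_self C]
      _ = ε / 2 := div_mul_cancel₀ _ hC.ne'
  calc ‖inner 𝕜 v (z y)‖ = ‖inner 𝕜 (v - w) (z y) + inner 𝕜 w (z y)‖ := by
        rw [← inner_add_left, sub_add_cancel]
    _ < ε := by linarith [norm_add_le (inner 𝕜 (v - w) (z y)) (inner 𝕜 w (z y))]

variable [CompleteSpace H]

lemma tendsto_inner_zero_of_pairwise (hbound : ∀ y, ‖z y‖ ≤ C)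
    (hz : ∀ x, Tendsto (fun y => inner 𝕜 (z x) (z y)) l (𝓝 0)) (v : H) :
    Tendsto (fun y => inner 𝕜 v (z y)) l (𝓝 0) := by
  let K := (Submodule.span 𝕜 (Set.range z)).topologicalClosure
  have hspan (w : H) (hw : w ∈ Submodule.span 𝕜 (Set.range z)) :
      Tendsto (fun y => inner 𝕜 w (z y)) l (𝓝 0) := by
    induction hw using Submodule.span_induction with
    | mem w hw => obtain ⟨x, rfl⟩ := hw; exact hz x
    | zero => simpa only [inner_zero_left] using tendsto_const_nhds
    | add w w' _ _ hw hw' => simpa only [inner_add_left, add_zero] using hw.add hw'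
    | smul c w _ hw => simpa only [inner_smul_left, mul_zero] using hw.const_mul _
  have hzK (y : Y) : z y ∈ K :=
    Submodule.le_topologicalClosure _ (Submodule.subset_span (Set.mem_range_self y))
  have : CompleteSpace K := (Submodule.isClosed_topologicalClosure _).completeSpace_coe
  refine (tendsto_inner_zero_of_mem_closure hbound hspan
    (K.starProjection_apply_mem v)).congr fun y => ?_
  rw [Submodule.inner_starProjection_left_eq_right, K.starProjection_eq_self_iff.2 (hzK y)]

lemma tendsto_inner_of_pairwise {x : Y → H} {e : H} {m : 𝕜} (he : ‖e‖ = 1)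
    (hbound : ∀ y, ‖x y‖ ≤ C) (hmean : ∀ y, inner 𝕜 e (x y) = m)
    (hx : ∀ y', Tendsto (fun y => inner 𝕜 (x y') (x y)) l (𝓝 (m * (starRingEnd 𝕜) m))) (v : H) :
    Tendsto (fun y => inner 𝕜 v (x y)) l (𝓝 (m * inner 𝕜 v e)) := by
  have hcentered (y' y : Y) : inner 𝕜 (x y' - m • e) (x y - m • e) =
      inner 𝕜 (x y') (x y) - m * (starRingEnd 𝕜) m := by
    rw [inner_sub_left, inner_sub_right, inner_sub_right, inner_smul_left, inner_smul_left,
      inner_smul_right, inner_smul_right, hmean, ← inner_conj_symm (x y') e, hmean,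
      inner_self_eq_norm_sq_to_K, he]
    simp only [RCLike.ofReal_one, one_pow, mul_one]
    ring
  have hzero : Tendsto (fun y => inner 𝕜 v (x y - m • e)) l (𝓝 0) := by
    refine tendsto_inner_zero_of_pairwise (C := C + ‖m • e‖)
      (fun y => (norm_sub_le _ _).trans (by gcongr; exact hbound y)) (fun y' => ?_) v
    simp_rw [hcentered]
    exact tendsto_sub_nhds_zero_iff.2 (hx y')
  simp_rw [inner_sub_right, inner_smul_right] at hzero
  exact tendsto_sub_nhds_zero_iff.1 hzero

end WeakConvergence

section InvariantEvent

variable {Ω Y : Type*} [MeasurableSpace Ω] {μ : Measure Ω} {F : Ω → ℂ}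

lemma setIntegral_comp_of_preimage_ae_eq {T : Ω → Ω} (hT : MeasurePreserving T μ μ)
    (hF : AEStronglyMeasurable F μ) {B : Set Ω} (hB : MeasurableSet B) (hinv : T ⁻¹' B =ᵐ[μ] B) :
    ∫ ω in B, F (T ω) ∂μ = ∫ ω in B, F ω ∂μ := by
  rw [← setIntegral_congr_set hinv,
    ← setIntegral_map hB (by rwa [hT.map_eq]) hT.measurable.aemeasurable, hT.map_eq]

lemma inner_toLp_toLp {𝕜 : Type*} [RCLike 𝕜] {F G : Ω → 𝕜} (hF : MemLp F 2 μ)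
    (hG : MemLp G 2 μ) :
    inner 𝕜 (hF.toLp F) (hG.toLp G) = ∫ ω, G ω * (starRingEnd 𝕜) (F ω) ∂μ := by
  rw [L2.inner_def]
  refine integral_congr_ae ?_
  filter_upwards [hF.coeFn_toLp, hG.coeFn_toLp] with ω hFω hGω
  rw [hFω, hGω, RCLike.inner_apply]

lemma setIntegral_eq_of_tendsto_integral_mul_conj [IsProbabilityMeasure μ] {T : Y → Ω → Ω}
    {l : Filter Y} [l.NeBot] (hT : ∀ y, MeasurePreserving (T y) μ μ) (hF : MemLp F 2 μ)
    (hmix : ∀ x, Tendsto (fun y => ∫ ω, F (T y ω) * (starRingEnd ℂ) (F (T x ω)) ∂μ) l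
      (𝓝 ((∫ ω, F ω ∂μ) * (starRingEnd ℂ) (∫ ω, F ω ∂μ))))
    {B : Set Ω} (hB : MeasurableSet B) (hinv : ∀ y, T y ⁻¹' B =ᵐ[μ] B) :
    ∫ ω in B, F ω ∂μ = μ.real B * ∫ ω, F ω ∂μ := by
  have hFT (y : Y) : MemLp (F ∘ T y) 2 μ := hF.comp_measurePreserving (hT y)
  let x (y : Y) : Lp ℂ 2 μ := (hFT y).toLp _
  let ind (A : Set Ω) (hA : MeasurableSet A) : Lp ℂ 2 μ :=
    indicatorConstLp 2 hA (measure_ne_top μ A) 1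
  have h_ind (y : Y) {A : Set Ω} (hA : MeasurableSet A) (hinvA : T y ⁻¹' A =ᵐ[μ] A) :
      inner ℂ (ind A hA) (x y) = ∫ ω in A, F ω ∂μ := by
    rw [L2.inner_indicatorConstLp_one,
      ← setIntegral_comp_of_preimage_ae_eq (hT y) hF.aestronglyMeasurable hA hinvA]
    exact integral_congr_ae (ae_restrict_of_ae (hFT y).coeFn_toLp)
  have h_inner (y' y : Y) :
      inner ℂ (x y') (x y) = ∫ ω, F (T y ω) * (starRingEnd ℂ) (F (T y' ω)) ∂μ :=
    inner_toLp_toLp (hFT y') (hFT y)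
  have h_norm (y : Y) : ‖x y‖ ≤ (eLpNorm F 2 μ).toReal := by
    rw [Lp.norm_toLp, eLpNorm_comp_measurePreserving hF.aestronglyMeasurable (hT y)]
  have h_one : ‖ind Set.univ MeasurableSet.univ‖ = 1 := by
    rw [norm_indicatorConstLp two_ne_zero ENNReal.ofNat_ne_top, norm_one, probReal_univ,
      Real.one_rpow, one_mul]
  have hweak := tendsto_inner_of_pairwise (l := l) (𝕜 := ℂ) (e := ind Set.univ MeasurableSet.univ)
    (m := ∫ ω, F ω ∂μ) h_one h_norm
    (fun y => by rw [h_ind y _ (by rfl), setIntegral_univ])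
    (fun y' => by simpa only [h_inner] using hmix y') (ind B hB)
  simp_rw [fun y => h_ind y hB (hinv y)] at hweak
  rw [tendsto_nhds_unique tendsto_const_nhds hweak, mul_comm,
    L2.inner_indicatorConstLp_one_indicatorConstLp_one, Set.inter_univ]
  rfl

end InvariantEvent

section GaussianProcess

lemma ext_of_integral_cexp_sum {ι : Type*} {μ ν : Measure (ι → ℝ)} [IsFiniteMeasure μ]
    [IsFiniteMeasure ν]
    (h : ∀ (s : Finset ι) (c : s → ℝ), ∫ x, Complex.exp (((∑ i : s, c i * x i : ℝ) : ℂ) * I) ∂μ =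
      ∫ x, Complex.exp (((∑ i : s, c i * x i : ℝ) : ℂ) * I) ∂ν) : μ = ν := by
  classical
  refine IsProjectiveLimit.unique (P := fun s => ν.map s.restrict) (fun s => ?_) (fun _ => rfl)
  refine Measure.ext_of_charFunDual (funext fun L => ?_)
  have hL (x : ι → ℝ) : L (s.restrict x) = ∑ i : s, L (Pi.single i 1) * x i := by
    rw [pi_eq_sum_univ' (s.restrict x), map_sum]
    exact Finset.sum_congr rfl fun i _ => by rw [map_smul, smul_eq_mul, mul_comm]; rfl
  have hchar (ρ : Measure (ι → ℝ)) : charFunDual (ρ.map s.restrict) L =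
      ∫ x, Complex.exp (((∑ i : s, L (Pi.single i 1) * x i : ℝ) : ℂ) * I) ∂ρ := by
    rw [charFunDual_apply,
      integral_map (Finset.measurable_restrict s).aemeasurable (by fun_prop)]
    simp_rw [hL]
  rw [hchar, hchar]
  exact h s fun i => L (Pi.single i 1)

section Character

variable {Ω : Type*} [MeasurableSpace Ω] {P : Measure Ω} {U V : Ω → ℝ}

lemma integral_cexp_mul_I_of_hasGaussianLaw (hU : HasGaussianLaw U P) :
    ∫ ω, Complex.exp (U ω * I) ∂P = Complex.exp (((∫ ω, U ω ∂P : ℝ) : ℂ) * I - Var[U; P] / 2) := by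
  have h := hU.charFun_map_eq 1
  rw [charFun_apply_real, integral_map hU.aemeasurable (by fun_prop)] at h
  simpa only [Complex.ofReal_one, one_mul, RCLike.inner_apply, conj_trivial, mul_one] using h

lemma integral_cexp_mul_I_mul_conj_of_hasGaussianLaw
    (hUV : HasGaussianLaw (fun ω => (U ω, V ω)) P) :
    ∫ ω, Complex.exp (U ω * I) * (starRingEnd ℂ) (Complex.exp (V ω * I)) ∂P =
      (∫ ω, Complex.exp (U ω * I) ∂P) * (starRingEnd ℂ) (∫ ω, Complex.exp (V ω * I) ∂P) *
        Complex.exp cov[U, V; P] := by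
  have := hUV.isProbabilityMeasure
  have hU := hUV.fst
  have hV := hUV.snd
  have hdiff (ω : Ω) : Complex.exp (U ω * I) * (starRingEnd ℂ) (Complex.exp (V ω * I)) =
      Complex.exp ((U ω - V ω : ℝ) * I) := by
    rw [← Complex.exp_conj, map_mul, Complex.conj_ofReal, Complex.conj_I, ← Complex.exp_add]
    push_cast
    ring_nf
  simp_rw [hdiff]
  rw [integral_cexp_mul_I_of_hasGaussianLaw hUV.fun_sub, integral_cexp_mul_I_of_hasGaussianLaw hU,
    integral_cexp_mul_I_of_hasGaussianLaw hV, variance_fun_sub hU.memLp_two hV.memLp_two,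
    integral_sub (hU.memLp_two.integrable one_le_two) (hV.memLp_two.integrable one_le_two),
    ← Complex.exp_conj, ← Complex.exp_add, ← Complex.exp_add]
  simp only [map_sub, map_mul, map_div₀, map_ofNat, Complex.conj_ofReal, Complex.conj_I]
  push_cast
  ring_nf

end Character

section LinearCombination

variable {Ω ι κ : Type*} [MeasurableSpace Ω] {P : Measure Ω} {X : ι → Ω → ℝ} [Fintype κ]

lemma isGaussianProcess_sum_mul (hX : IsGaussianProcess X P) (c : κ → ℝ) :
    IsGaussianProcess (fun (i : κ → ι) ω => ∑ k, c k * X (i k) ω) P := by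
  classical
  refine hX.of_isGaussianProcess fun i => ⟨Finset.univ.image i, ∑ k, c k •
    ContinuousLinearMap.proj ⟨i k, Finset.mem_image_of_mem i (Finset.mem_univ k)⟩, fun ω => ?_⟩
  simp

lemma covariance_sum_mul_sum_mul (hX : IsGaussianProcess X P) (c : κ → ℝ) (i j : κ → ι) :
    cov[fun ω => ∑ k, c k * X (i k) ω, fun ω => ∑ k, c k * X (j k) ω; P] =
      ∑ k, ∑ k', c k * c k' * cov[X (i k), X (j k'); P] := by
  have := hX.isProbabilityMeasure
  have hmem (i : ι) (a : ℝ) : MemLp (fun ω => a * X i ω) 2 P :=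
    (hX.hasGaussianLaw_eval i).memLp_two.const_mul a
  rw [covariance_fun_sum_fun_sum (fun k => hmem _ _) fun k => hmem _ _]
  simp_rw [covariance_const_mul_left, covariance_const_mul_right, mul_assoc]

lemma integral_sum_mul (hX : IsGaussianProcess X P) (c : κ → ℝ) (i : κ → ι) :
    ∫ ω, ∑ k, c k * X (i k) ω ∂P = ∑ k, c k * ∫ ω, X (i k) ω ∂P := by
  have := hX.isProbabilityMeasure
  rw [integral_finsetSum _ fun k _ =>
    ((hX.hasGaussianLaw_eval (i k)).memLp_two.integrable one_le_two).const_mul _]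
  simp_rw [integral_const_mul]

end LinearCombination

section Canonical

variable {ι Y : Type*} {μ : Measure (ι → ℝ)}

lemma measurePreserving_comp_of_covariance_eq (hμ : IsGaussianProcess (fun i (η : ι → ℝ) => η i) μ)
    {τ : ι → ι} (hmean : ∀ i, ∫ η, η (τ i) ∂μ = ∫ η, η i ∂μ)
    (hcov : ∀ i j, cov[fun η => η (τ i), fun η => η (τ j); μ] =
      cov[fun η => η i, fun η => η j; μ]) :
    MeasurePreserving (fun η : ι → ℝ => η ∘ τ) μ μ := by
  have := hμ.isProbabilityMeasure
  have hm : Measurable fun η : ι → ℝ => η ∘ τ := by fun_prop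
  have := Measure.isProbabilityMeasure_map (μ := μ) hm.aemeasurable
  refine ⟨hm, ext_of_integral_cexp_sum fun s c => ?_⟩
  have hgauss (i : s → ι) : HasGaussianLaw (fun η : ι → ℝ => ∑ k, c k * η (i k)) μ :=
    (isGaussianProcess_sum_mul hμ c).hasGaussianLaw_eval i
  rw [integral_map hm.aemeasurable (Measurable.aestronglyMeasurable (by fun_prop))]
  simp only [Function.comp_apply]
  rw [integral_cexp_mul_I_of_hasGaussianLaw (hgauss fun k => τ k),
    integral_cexp_mul_I_of_hasGaussianLaw (hgauss fun k => k),
    ← covariance_self (hgauss fun k => τ k).aemeasurable,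
    ← covariance_self (hgauss fun k => k).aemeasurable,
    covariance_sum_mul_sum_mul hμ, covariance_sum_mul_sum_mul hμ,
    integral_sum_mul hμ, integral_sum_mul hμ]
  simp_rw [hmean, hcov]

variable {τ : Y → ι → ι} {l : Filter Y} [l.NeBot] {B : Set (ι → ℝ)}

lemma setIntegral_cexp_sum_of_tendsto_covariance
    (hμ : IsGaussianProcess (fun i (η : ι → ℝ) => η i) μ)
    (hτ : ∀ y, MeasurePreserving (fun η : ι → ℝ => η ∘ τ y) μ μ)
    (hcov : ∀ i j, Tendsto (fun y => cov[fun η => η i, fun η => η (τ y j); μ]) l (𝓝 0))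
    (hB : MeasurableSet B) (hinv : ∀ y, (fun η : ι → ℝ => η ∘ τ y) ⁻¹' B =ᵐ[μ] B)
    (s : Finset ι) (c : s → ℝ) :
    ∫ η in B, Complex.exp (((∑ i : s, c i * η i : ℝ) : ℂ) * I) ∂μ =
      μ.real B * ∫ η, Complex.exp (((∑ i : s, c i * η i : ℝ) : ℂ) * I) ∂μ := by
  have := hμ.isProbabilityMeasure
  let F (η : ι → ℝ) : ℂ := Complex.exp (((∑ i : s, c i * η i : ℝ) : ℂ) * I)
  let U (y : Y) (η : ι → ℝ) : ℝ := ∑ i : s, c i * η (τ y i)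
  have hF : Measurable F := by fun_prop
  have hF_memLp : MemLp F 2 μ := MemLp.of_bound hF.aestronglyMeasurable 1
    (Eventually.of_forall fun η => (Complex.norm_exp_ofReal_mul_I _).le)
  have hmean (y : Y) : ∫ η, Complex.exp (U y η * I) ∂μ = ∫ η, F η ∂μ := by
    have h := integral_map (μ := μ) (hτ y).measurable.aemeasurable hF.aestronglyMeasurable
    rw [(hτ y).map_eq] at h
    exact h.symm
  have hcovU (x : Y) : Tendsto (fun y => cov[U y, U x; μ]) l (𝓝 0) := by
    simp_rw [covariance_comm _ (U x), U,
      fun y => covariance_sum_mul_sum_mul hμ c (fun k : s => τ x k) (fun k : s => τ y k)]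
    simpa only [mul_zero, Finset.sum_const_zero] using
      tendsto_finsetSum Finset.univ fun (k : s) _ => tendsto_finsetSum Finset.univ fun (k' : s) _ =>
        (hcov (τ x k) k').const_mul (c k * c k')
  refine setIntegral_eq_of_tendsto_integral_mul_conj (l := l) hτ hF_memLp (fun x => ?_) hB hinv
  have hjoint (y : Y) : ∫ η, F (η ∘ τ y) * (starRingEnd ℂ) (F (η ∘ τ x)) ∂μ =
      (∫ η, F η ∂μ) * (starRingEnd ℂ) (∫ η, F η ∂μ) * Complex.exp cov[U y, U x; μ] := by
    have h := integral_cexp_mul_I_mul_conj_of_hasGaussianLaw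
      ((isGaussianProcess_sum_mul hμ c).hasGaussianLaw_prodMk
        (s := fun k : s => τ y k) (t := fun k : s => τ x k))
    rwa [hmean y, hmean x] at h
  simp_rw [hjoint]
  have hexp : Continuous fun t : ℝ =>
      (∫ η, F η ∂μ) * (starRingEnd ℂ) (∫ η, F η ∂μ) * Complex.exp t := by fun_prop
  simpa only [Complex.ofReal_zero, Complex.exp_zero, mul_one, Function.comp_def] using
    (hexp.tendsto 0).comp (hcovU x)

theorem measure_eq_zero_or_one_of_tendsto_covariance
    (hμ : IsGaussianProcess (fun i (η : ι → ℝ) => η i) μ)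
    (hτ : ∀ y, MeasurePreserving (fun η : ι → ℝ => η ∘ τ y) μ μ)
    (hcov : ∀ i j, Tendsto (fun y => cov[fun η => η i, fun η => η (τ y j); μ]) l (𝓝 0))
    (hB : MeasurableSet B) (hinv : ∀ y, (fun η : ι → ℝ => η ∘ τ y) ⁻¹' B =ᵐ[μ] B) :
    μ B = 0 ∨ μ B = 1 := by
  have := hμ.isProbabilityMeasure
  have : IsFiniteMeasure (μ B • μ) := Measure.smul_finite μ (measure_ne_top μ B)
  have hindep : μ.restrict B = μ B • μ := ext_of_integral_cexp_sum fun s c => by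
    rw [setIntegral_cexp_sum_of_tendsto_covariance hμ hτ hcov hB hinv, integral_smul_measure,
      Complex.real_smul, measureReal_def]
  have hsq : μ B = μ B * μ B := by
    simpa only [Measure.restrict_apply_self, Measure.smul_apply, smul_eq_mul] using
      congrArg (fun ρ : Measure (ι → ℝ) => ρ B) hindep
  refine or_iff_not_imp_left.2 fun h0 => ?_
  rw [← ENNReal.mul_right_inj h0 (measure_ne_top μ B), ← hsq, mul_one]

end Canonical

end GaussianProcess

section Noise

/-- The action of the shifts on the indices of the noise: `shiftNoise y η = η ∘ shiftIdx y`. -/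
noncomputable def shiftIdx (y : E d) (i : Idx d) : Idx d :=
  (i.1, SchwartzMap.compSubConstCLM ℝ y i.2)

lemma measurable_shiftNoise (y : E d) : Measurable (shiftNoise y) :=
  measurable_pi_lambda _ fun _ => measurable_pi_apply _

lemma shiftNoise_shiftNoise (x y : E d) (η : Idx d → ℝ) :
    shiftNoise x (shiftNoise y η) = shiftNoise (x + y) η := by
  funext i
  simp [shiftNoise]

/-- The law of the noise on the space of its configurations. -/
noncomputable def noiseLaw {Ω : Type*} [MeasurableSpace Ω] (W : Idx d → Ω → ℝ) (P : Measure Ω) :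
    Measure (Idx d → ℝ) :=
  P.map fun ω i => W i ω

/-- The realization `x ↦ G(η_x)` of the field of `G` as a function of the configuration `η`. -/
noncomputable def shiftOrbit (G : (Idx d → ℝ) → ℝ) (η : Idx d → ℝ) (x : E d) : ℝ :=
  G (shiftNoise x η)

lemma shiftOrbit_shiftNoise (G : (Idx d → ℝ) → ℝ) (y : E d) (η : Idx d → ℝ) :
    shiftOrbit G (shiftNoise y η) = fun x => shiftOrbit G η (x + y) :=
  funext fun x => congrArg G (shiftNoise_shiftNoise x y η)

variable {G : (Idx d → ℝ) → ℝ}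

lemma measurable_shiftOrbit (hG : Measurable G) : Measurable (shiftOrbit G) :=
  measurable_pi_lambda _ fun x => hG.comp (measurable_shiftNoise x)

variable {Ω : Type*} [MeasurableSpace Ω] {f ν : Measure (E d)} {W : Idx d → Ω → ℝ} {P : Measure Ω}

namespace IsNoise

lemma measurable_config (hW : IsNoise f W P) : Measurable fun ω i => W i ω :=
  measurable_pi_lambda _ hW.measurable

lemma isProbabilityMeasure_noiseLaw (hW : IsNoise f W P) : IsProbabilityMeasure (noiseLaw W P) :=
  have := hW.gaussian.isProbabilityMeasure
  Measure.isProbabilityMeasure_map hW.measurable_config.aemeasurable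

lemma isGaussianProcess_noiseLaw (hW : IsNoise f W P) :
    IsGaussianProcess (fun i (η : Idx d → ℝ) => η i) (noiseLaw W P) := by
  refine ⟨fun s => ⟨?_⟩⟩
  rw [noiseLaw, Measure.map_map (by fun_prop) hW.measurable_config]
  exact (hW.gaussian.hasGaussianLaw s).isGaussian_map

lemma integral_noiseLaw (hW : IsNoise f W P) (i : Idx d) : ∫ η, η i ∂(noiseLaw W P) = 0 := by
  rw [noiseLaw, integral_map hW.measurable_config.aemeasurable
    (measurable_pi_apply i).aestronglyMeasurable]
  exact hW.centered i

lemma covariance_noiseLaw (hW : IsNoise f W P) (i j : Idx d) :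
    cov[fun η => η i, fun η => η j; noiseLaw W P] =
      ((min i.1 j.1 : ℝ≥0) : ℝ) * pairing f i.2 j.2 := by
  rw [noiseLaw, covariance_map (measurable_pi_apply _).aestronglyMeasurable
    (measurable_pi_apply _).aestronglyMeasurable hW.measurable_config.aemeasurable]
  exact hW.covariance_eq i.1 j.1 i.2 j.2

lemma measurePreserving_shiftNoise (hW : IsNoise f W P) (y : E d) :
    MeasurePreserving (shiftNoise y) (noiseLaw W P) (noiseLaw W P) := by
  refine measurePreserving_comp_of_covariance_eq (τ := shiftIdx y) hW.isGaussianProcess_noiseLaw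
    (fun i => ?_) fun i j => ?_
  · rw [hW.integral_noiseLaw, hW.integral_noiseLaw]
  · rw [hW.covariance_noiseLaw, hW.covariance_noiseLaw]
    exact congrArg _ (pairing_translate_translate f i.2 j.2 y)

theorem noiseLaw_eq_zero_or_one_of_invariant [f.HasTemperateGrowth] [ν.HasTemperateGrowth]
    (hW : IsNoise f W P) (hν : IsFourierTransform f ν) (hatom : ν {0} = 0) {B : Set (Idx d → ℝ)}
    (hB : MeasurableSet B) (hinv : ∀ y : E d, shiftNoise y ⁻¹' B =ᵐ[noiseLaw W P] B) :
    noiseLaw W P B = 0 ∨ noiseLaw W P B = 1 := by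
  refine measure_eq_zero_or_one_of_tendsto_covariance (τ := shiftIdx)
    (l := densityOneFilter (wideGaussian (E d)) atTop) hW.isGaussianProcess_noiseLaw
    hW.measurePreserving_shiftNoise (fun i j => ?_) hB hinv
  have hlim : Tendsto (fun y => ((min i.1 j.1 : ℝ≥0) : ℝ) *
      pairing f i.2 (SchwartzMap.compSubConstCLM ℝ y j.2))
      (densityOneFilter (wideGaussian (E d)) atTop) (𝓝 0) := by
    simpa only [mul_zero] using
      (hν.tendsto_pairing_translate hatom i.2 j.2).const_mul ((min i.1 j.1 : ℝ≥0) : ℝ)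
  exact hlim.congr fun y => (hW.covariance_noiseLaw i (shiftIdx y j)).symm

theorem isStationaryField_shiftField (hW : IsNoise f W P) (hG : Measurable G) :
    IsStationaryField P (shiftField W G) := by
  intro y
  have hη := hW.measurable_config
  have hshift := hW.measurePreserving_shiftNoise y
  have hident : IdentDistrib (fun ω => shiftNoise y fun i => W i ω) (fun ω i => W i ω) P P :=
    ⟨(hshift.measurable.comp hη).aemeasurable, hη.aemeasurable,
      (Measure.map_map hshift.measurable hη).symm.trans hshift.map_eq⟩
  have horbit := hident.comp (measurable_shiftOrbit hG)
  simp only [Function.comp_def, shiftOrbit_shiftNoise] at horbit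
  exact horbit

lemma map_shiftField (hW : IsNoise f W P) (hG : Measurable G) :
    P.map (fun ω x => shiftField W G x ω) = (noiseLaw W P).map (shiftOrbit G) :=
  (Measure.map_map (measurable_shiftOrbit hG) hW.measurable_config).symm

theorem isErgodicField_shiftField [f.HasTemperateGrowth] [ν.HasTemperateGrowth]
    (hW : IsNoise f W P) (hν : IsFourierTransform f ν) (hatom : ν {0} = 0) (hG : Measurable G) :
    IsErgodicField P (shiftField W G) := by
  intro A hA hinv
  have hΨ := measurable_shiftOrbit hG
  simp only [hW.map_shiftField hG] at hinv ⊢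
  rw [Measure.map_apply hΨ hA]
  refine hW.noiseLaw_eq_zero_or_one_of_invariant hν hatom (hΨ hA) fun y => ?_
  have hpre := (hΨ.quasiMeasurePreserving (noiseLaw W P)).preimage_ae_eq (hinv y)
  rwa [← Set.preimage_comp, Function.comp_def, ← funext (shiftOrbit_shiftNoise G y)] at hpre

end IsNoise

end Noise

section FixedPoint

variable {H : Type*} [NormedAddCommGroup H] [InnerProductSpace ℝ H] {v : ℝ}

lemma cauchySeq_of_tendsto_inner {β : Type*} [SemilatticeSup β] [Nonempty β] {x : β → H}
    (hx : Tendsto (fun p : β × β => inner ℝ (x p.1) (x p.2)) atTop (𝓝 v)) : CauchySeq x := by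
  rw [cauchySeq_iff_tendsto_dist_atTop_0]
  have hfst : Tendsto (fun p : β × β => (p.1, p.1)) atTop atTop := by
    rw [← prod_atTop_atTop_eq]
    exact tendsto_fst.prodMk tendsto_fst
  have hsnd : Tendsto (fun p : β × β => (p.2, p.2)) atTop atTop := by
    rw [← prod_atTop_atTop_eq]
    exact tendsto_snd.prodMk tendsto_snd
  have hsq : Tendsto (fun p : β × β => ‖x p.1 - x p.2‖ ^ 2) atTop (𝓝 (v - 2 * v + v)) :=
    (((hx.comp hfst).sub (hx.const_mul 2)).add (hx.comp hsnd)).congr fun p => by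
      rw [norm_sub_sq_real, Function.comp_apply, Function.comp_apply, real_inner_self_eq_norm_sq,
        real_inner_self_eq_norm_sq]
  rw [show v - 2 * v + v = 0 by ring] at hsq
  simpa only [dist_eq_norm, Real.sqrt_sq (norm_nonneg _), Real.sqrt_zero] using hsq.sqrt

lemma exists_tendsto_fixed_of_tendsto_inner [CompleteSpace H] {Y : Type*} {T : Y → H →ₗᵢ[ℝ] H}
    {x : ℕ → H} (hx : Tendsto (fun p : ℕ × ℕ => inner ℝ (x p.1) (x p.2)) atTop (𝓝 v))
    (hTx : ∀ y, Tendsto (fun n => inner ℝ (x n) (T y (x n))) atTop (𝓝 v)) :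
    ∃ g, Tendsto x atTop (𝓝 g) ∧ ‖g‖ ^ 2 = v ∧ ∀ y, T y g = g := by
  obtain ⟨g, hg⟩ := cauchySeq_tendsto_of_complete (cauchySeq_of_tendsto_inner hx)
  have hdiag : Tendsto (fun n : ℕ => (n, n)) atTop atTop := by
    rw [← prod_atTop_atTop_eq]
    exact tendsto_id.prodMk tendsto_id
  have hnorm : ‖g‖ ^ 2 = v := by
    rw [← real_inner_self_eq_norm_sq]
    exact tendsto_nhds_unique (hg.inner hg) (hx.comp hdiag)
  refine ⟨g, hg, hnorm, fun y => (eq_of_norm_le_re_inner_eq_norm_sq (𝕜 := ℝ)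
    ((T y).norm_map g).ge ?_).symm⟩
  rw [RCLike.re_to_real, (T y).norm_map, hnorm]
  exact tendsto_nhds_unique (hg.inner (((T y).continuous.tendsto g).comp hg)) (hTx y)

end FixedPoint

section InvariantFunction

variable {Ω Y : Type*} [MeasurableSpace Ω] {μ : Measure Ω} [IsProbabilityMeasure μ]

lemma not_ae_eq_const_of_integral_eq_zero {g : Lp ℝ 2 μ} (hmean : ∫ ω, g ω ∂μ = 0) (hg : g ≠ 0) :
    ¬ ∃ a : ℝ, g =ᵐ[μ] Function.const _ a := by
  rintro ⟨a, ha⟩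
  have ha0 : a = 0 := by simpa [hmean] using (integral_congr_ae ha).symm
  subst ha0
  exact hg (Lp.eq_zero_iff_ae_eq_zero.2 ha)

lemma exists_invariant_of_tendsto_integral_mul {T : Y → Ω → Ω}
    (hT : ∀ y, MeasurePreserving (T y) μ μ) {X : ℕ → Ω → ℝ} (hX : ∀ n, MemLp (X n) 2 μ)
    (hmean : ∀ n, ∫ ω, X n ω ∂μ = 0) {v : ℝ} (hv : v ≠ 0)
    (hXX : Tendsto (fun p : ℕ × ℕ => ∫ ω, X p.1 ω * X p.2 ω ∂μ) atTop (𝓝 v))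
    (hXT : ∀ y, Tendsto (fun n => ∫ ω, X n ω * X n (T y ω) ∂μ) atTop (𝓝 v)) :
    ∃ G : Ω → ℝ, Measurable G ∧ MemLp G 2 μ ∧ (∀ y, G ∘ T y =ᵐ[μ] G) ∧
      ¬ ∃ a : ℝ, G =ᵐ[μ] Function.const _ a := by
  let x (n : ℕ) : Lp ℝ 2 μ := (hX n).toLp _
  let U (y : Y) : Lp ℝ 2 μ →ₗᵢ[ℝ] Lp ℝ 2 μ := Lp.compMeasurePreservingₗᵢ ℝ (T y) (hT y)
  have hx (n m : ℕ) : inner ℝ (x n) (x m) = ∫ ω, X n ω * X m ω ∂μ := by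
    simp only [x, inner_toLp_toLp, conj_trivial, mul_comm]
  have hU (y : Y) (n : ℕ) : inner ℝ (x n) (U y (x n)) = ∫ ω, X n ω * X n (T y ω) ∂μ := by
    have hUx : U y (x n) = ((hX n).comp_measurePreserving (hT y)).toLp (X n ∘ T y) :=
      Lp.toLp_compMeasurePreserving (hX n) (hT y)
    rw [hUx, inner_toLp_toLp]
    simp only [Function.comp_apply, conj_trivial, mul_comm]
  obtain ⟨g, hxg, hnorm, hfix⟩ := exists_tendsto_fixed_of_tendsto_inner (T := U) (x := x)
    (by simpa only [hx] using hXX) (by simpa only [hU] using hXT)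
  have hmean_g : ∫ ω, g ω ∂μ = 0 := by
    let one : Lp ℝ 2 μ := indicatorConstLp 2 MeasurableSet.univ (measure_ne_top μ _) 1
    have hone (h : Lp ℝ 2 μ) : inner ℝ one h = ∫ ω, h ω ∂μ := by
      rw [L2.inner_indicatorConstLp_one, setIntegral_univ]
    refine tendsto_nhds_unique ?_ (tendsto_const_nhds (f := (atTop : Filter ℕ)))
    refine (hone g ▸ tendsto_const_nhds.inner hxg).congr fun n => ?_
    rw [hone, integral_congr_ae (hX n).coeFn_toLp, hmean]
  refine ⟨g, (Lp.stronglyMeasurable g).measurable, Lp.memLp g, fun y => ?_,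
    not_ae_eq_const_of_integral_eq_zero hmean_g ?_⟩
  · exact (Lp.coeFn_compMeasurePreserving g (hT y)).symm.trans (Lp.ext_iff.1 (hfix y))
  · rintro rfl
    exact hv (by simpa using hnorm.symm)

end InvariantFunction

section InvariantNoise

/-- The index of the Wiener integral over `(0, 1) × ℝ^d` of the `n`-th of a sequence of ever wider
Gaussian densities. -/
noncomputable def gaussIdx (d n : ℕ) : Idx d :=
  (1, gaussDensity (E d) ((n : ℝ) + 1) (by positivity))

variable {Ω : Type*} [MeasurableSpace Ω] {f ν : Measure (E d)} {W : Idx d → Ω → ℝ} {P : Measure Ω}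

namespace IsNoise

lemma memLp_noiseLaw (hW : IsNoise f W P) (i : Idx d) :
    MemLp (fun η : Idx d → ℝ => η i) 2 (noiseLaw W P) :=
  (hW.isGaussianProcess_noiseLaw.hasGaussianLaw_eval i).memLp_two

lemma integral_gaussIdx_mul_shiftNoise [f.HasTemperateGrowth] (hW : IsNoise f W P)
    (hν : IsFourierTransform f ν) (n m : ℕ) (y : E d) :
    ∫ η, η (gaussIdx d n) * shiftNoise y η (gaussIdx d m) ∂(noiseLaw W P) =
      ((2 * Real.pi) ^ d)⁻¹ *
        (∫ z, Complex.exp (-((n : ℝ) + 1 + (m + 1) : ℝ) * ‖z‖ ^ 2 + I * (inner ℝ y z : ℝ)) ∂ν).re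
    := by
  have := hW.isProbabilityMeasure_noiseLaw
  have hcov := hW.covariance_noiseLaw (gaussIdx d n) (shiftIdx y (gaussIdx d m))
  rw [covariance_eq_sub (hW.memLp_noiseLaw _) (hW.memLp_noiseLaw _), hW.integral_noiseLaw,
    zero_mul, sub_zero] at hcov
  refine hcov.trans ?_
  simp only [gaussIdx, shiftIdx, min_self, NNReal.coe_one, one_mul]
  exact hν.pairing_gaussDensity_translate _ _ y

lemma tendsto_integral_gaussIdx_mul_shiftNoise [f.HasTemperateGrowth] [ν.HasTemperateGrowth]
    (hW : IsNoise f W P) (hν : IsFourierTransform f ν) (y : E d) :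
    Tendsto (fun p : ℕ × ℕ =>
      ∫ η, η (gaussIdx d p.1) * shiftNoise y η (gaussIdx d p.2) ∂(noiseLaw W P)) atTop
      (𝓝 (((2 * Real.pi) ^ d)⁻¹ * ν.real {0})) := by
  have hwidth : Tendsto (fun p : ℕ × ℕ => (p.1 : ℝ) + 1 + (p.2 + 1)) atTop atTop := by
    rw [← prod_atTop_atTop_eq]
    exact (tendsto_atTop_add_const_right _ 1 (tendsto_natCast_atTop_atTop.comp tendsto_fst))
      |>.atTop_add_atTop
        (tendsto_atTop_add_const_right _ 1 (tendsto_natCast_atTop_atTop.comp tendsto_snd))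
  simp_rw [hW.integral_gaussIdx_mul_shiftNoise hν]
  exact ((Complex.continuous_re.tendsto _).comp
    ((tendsto_integral_cexp_atTop ν y).comp hwidth)).const_mul _

theorem exists_shift_invariant [f.HasTemperateGrowth] [ν.HasTemperateGrowth]
    (hW : IsNoise f W P) (hν : IsFourierTransform f ν) (hatom : ν {0} ≠ 0) :
    ∃ G : (Idx d → ℝ) → ℝ, Measurable G ∧ MemLp G 2 (noiseLaw W P) ∧
      (∀ y, G ∘ shiftNoise y =ᵐ[noiseLaw W P] G) ∧
      ¬ ∃ a : ℝ, G =ᵐ[noiseLaw W P] Function.const _ a := by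
  have := hW.isProbabilityMeasure_noiseLaw
  have := isLocallyFiniteMeasure_of_hasTemperateGrowth ν
  have hν_pos : 0 < ν.real {0} :=
    ENNReal.toReal_pos hatom isCompact_singleton.measure_lt_top.ne
  have hv : ((2 * Real.pi) ^ d)⁻¹ * ν.real {0} ≠ 0 := by positivity
  have hlim := hW.tendsto_integral_gaussIdx_mul_shiftNoise hν
  have hshift_zero (η : Idx d → ℝ) : shiftNoise 0 η = η := by
    funext i
    simp [shiftNoise]
  have hdiag : Tendsto (fun n : ℕ => (n, n)) atTop atTop := by
    rw [← prod_atTop_atTop_eq]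
    exact tendsto_id.prodMk tendsto_id
  have hXX : Tendsto (fun p : ℕ × ℕ =>
      ∫ η, η (gaussIdx d p.1) * η (gaussIdx d p.2) ∂(noiseLaw W P)) atTop
      (𝓝 (((2 * Real.pi) ^ d)⁻¹ * ν.real {0})) := by
    simpa only [hshift_zero] using hlim 0
  have hXT (y : E d) : Tendsto (fun n : ℕ =>
      ∫ η, η (gaussIdx d n) * shiftNoise y η (gaussIdx d n) ∂(noiseLaw W P)) atTop
      (𝓝 (((2 * Real.pi) ^ d)⁻¹ * ν.real {0})) := by
    simpa only [Function.comp_def] using (hlim y).comp hdiag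
  exact exists_invariant_of_tendsto_integral_mul (T := shiftNoise)
    (X := fun n η => η (gaussIdx d n)) hW.measurePreserving_shiftNoise
    (fun n => hW.memLp_noiseLaw (gaussIdx d n)) (fun n => hW.integral_noiseLaw (gaussIdx d n))
    hv hXX hXT

end IsNoise

end InvariantNoise

section ConstantField

variable {Ω : Type*} [MeasurableSpace Ω] {P : Measure Ω} {X : E d → Ω → ℝ}

lemma isContinuousInProbability_of_ae_eq (h : ∀ x y, X x =ᵐ[P] X y) :
    IsContinuousInProbability P X := fun x =>
  TendstoInMeasure.congr_left (f := fun _ => X x) (h x) fun ε hε => by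
    simp [hε.ne']

lemma ae_eq_const_of_isErgodicField [IsProbabilityMeasure P] (hX : ∀ x, Measurable (X x))
    (h : ∀ x y, X x =ᵐ[P] X y) (herg : IsErgodicField P X) :
    ∃ a : ℝ, X 0 =ᵐ[P] Function.const _ a := by
  have hfield : Measurable fun ω x => X x ω := measurable_pi_lambda _ hX
  refine exists_eventuallyEq_const_of_forall_separating MeasurableSet fun U hU => ?_
  let A : Set (E d → ℝ) := {u | u 0 ∈ U}
  have hA : MeasurableSet A := measurable_pi_apply 0 hU
  have hinv (y : E d) : (fun (u : E d → ℝ) (x : E d) => u (x + y)) ⁻¹' A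
      =ᵐ[P.map fun ω x => X x ω] A := by
    have hu : ∀ᵐ u ∂(P.map fun ω x => X x ω), u (0 + y) = u 0 :=
      (ae_map_iff hfield.aemeasurable (measurableSet_eq_fun (measurable_pi_apply _)
        (measurable_pi_apply _))).2 (h (0 + y) 0)
    filter_upwards [hu] with u hu
    exact congrArg (· ∈ U) hu
  have h01 := herg A hA hinv
  rw [Measure.map_apply hfield hA] at h01
  rcases h01 with h0 | h1
  · exact Or.inr (measure_eq_zero_iff_ae_notMem.1 h0)
  · exact Or.inl ((mem_ae_iff_prob_eq_one (hX 0 hU)).2 h1)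

end ConstantField

theorem IsNoise.exists_not_isErgodicField {Ω : Type*} [MeasurableSpace Ω] {f ν : Measure (E d)}
    {W : Idx d → Ω → ℝ} {P : Measure Ω} [f.HasTemperateGrowth] [ν.HasTemperateGrowth]
    (hW : IsNoise f W P) (hν : IsFourierTransform f ν) (hatom : ν {0} ≠ 0) :
    ∃ G : (Idx d → ℝ) → ℝ, IsL2Functional W P G ∧
      IsContinuousInProbability P (shiftField W G) ∧ ¬ IsErgodicField P (shiftField W G) := by
  have := hW.gaussian.isProbabilityMeasure
  obtain ⟨G, hG, hG_memLp, hinv, hconst⟩ := hW.exists_shift_invariant hν hatom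
  have hη := hW.measurable_config
  have hfield (x : E d) : shiftField W G x =ᵐ[P] fun ω => G fun i => W i ω :=
    ae_of_ae_map hη.aemeasurable (hinv x)
  have hae (x y : E d) : shiftField W G x =ᵐ[P] shiftField W G y :=
    (hfield x).trans (hfield y).symm
  refine ⟨G, ⟨hG, ?_⟩, isContinuousInProbability_of_ae_eq hae, fun herg => hconst ?_⟩
  · exact (memLp_map_measure_iff hG.aestronglyMeasurable hη.aemeasurable).1 hG_memLp
  · obtain ⟨a, ha⟩ := ae_eq_const_of_isErgodicField
      (fun x => hG.comp ((measurable_shiftNoise x).comp hη)) hae herg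
    refine ⟨a, ?_⟩
    exact (ae_map_iff hη.aemeasurable (measurableSet_eq_fun hG measurable_const)).2
      ((hfield 0).symm.trans ha)

end NoiseErgodicity

open NoiseErgodicity in
theorem theorem3p5_general {d : ℕ} {Ω : Type*} [MeasurableSpace Ω] {f : Measure (E d)}
    [f.HasTemperateGrowth] (hf : IsNonnegDefinite f) {W : Idx d → Ω → ℝ} {P : Measure Ω}
    (hW : IsNoise f W P) :
    (∀ G : (Idx d → ℝ) → ℝ, Measurable G → IsStationaryField P (shiftField W G)) ∧
    List.TFAE [∀ G : (Idx d → ℝ) → ℝ, Measurable G → IsErgodicField P (shiftField W G),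
      ∀ G : (Idx d → ℝ) → ℝ, IsL2Functional W P G →
        IsContinuousInProbability P (shiftField W G) → IsErgodicField P (shiftField W G),
      spectralMeasure f {0} = 0] := by
  obtain ⟨_, hν⟩ := hf.spectralMeasure_spec
  refine ⟨fun G hG => hW.isStationaryField_shiftField hG, ?_⟩
  tfae_have 1 → 2 := fun h G hG _ => h G hG.1
  tfae_have 2 → 3 := fun h => by
    by_contra hatom
    obtain ⟨G, hG, hcont, hnot⟩ := hW.exists_not_isErgodicField hν hatom
    exact hnot (h G hG hcont)
  tfae_have 3 → 1 := fun hatom G hG => hW.isErgodicField_shiftField hν hatom hG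
  tfae_finish

open NoiseErgodicity in
theorem theorem3p5 {d : ℕ} (f : Measure (E d)) (hf_temp : f.HasTemperateGrowth)
    (hf_pos : IsNonnegDefinite f)
    {Ω : Type*} [MeasurableSpace Ω] (P : Measure Ω) [IsProbabilityMeasure P]
    (W : Idx d → Ω → ℝ) (hW : IsNoise f W P) :
    (∀ G : (Idx d → ℝ) → ℝ, IsL2Functional W P G → IsStationaryField P (shiftField W G)) ∧
    ((∀ G : (Idx d → ℝ) → ℝ, IsL2Functional W P G →
        IsContinuousInProbability P (shiftField W G) → IsErgodicField P (shiftField W G)) ↔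
      spectralMeasure f {0} = 0) := by
  have h := theorem3p5_general hf_pos hW
  exact ⟨fun G hG => h.1 G hG.1, h.2.out 1 2⟩
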